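/- Let $k$ be an algebraically closed field of characteristic $0$. A 2-vector space over $k$ is a semisimple abelian $k$-linear category (every object is a finite direct sum of simple objects) with finite-dimensional Hom spaces and finitely many isomorphism classes of simple objects; the number of these classes is its dimension $\operatorname{Dim}$. For a $k$-linear category $\mathcal V$ and $n\ge 0$, let $\mathcal V^{\boxtimes n}$ be the category whose objects are formal finite direct sums of formal tensor products $V_1\boxtimes\cdots\boxtimes V_n$ of objects of $\mathcal V$ and whose morphisms are matrices with entries in $\operatorname{Hom}(V_1,W_1)\otimes_k\cdots\otimes_k\operatorname{Hom}(V_n,W_n)$. The symmetric group $S_n$ acts on it by $\sigma(V_1\boxtimes\cdots\boxtimes V_n)=V_{\sigma^{-1}(1)}\boxtimes\cdots\boxtimes V_{\sigma^{-1}(n)}$, and $\operatorname{Sym}^n(\mathcal V)=(\mathcal V^{\boxtimes n})^{S_n}$ is the category of $S_n$-equivariant objects of $\mathcal V^{\boxtimes n}$. If $\mathcal V$ is a 2-vector space over $k$ of dimension $d$, then every $\operatorname{Sym}^n(\mathcal V)$ is a 2-vector space, and in $\mathbb Z[[q]]$ $$\sum_{n\ge 0}\operatorname{Dim}\operatorname{Sym}^n(\mathcal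 V)\,q^n=\frac{1}{\phi(q)^d},\qquad \phi(q)=\prod_{n\ge 1}(1-q^n).$$ In particular, for the category $[1]$ of finite-dimensional $k$-vector spaces and every $n\ge 0$, there is a $k$-linear equivalence between $\operatorname{Sym}^n[1]$ and the category $\operatorname{Rep}(S_n)$ of finite-dimensional representations of $S_n$ over $k$, and each of these two categories has exactly $p(n)$ isomorphism classes of simple objects, where $p(n)$ is the number of partitions of $n$. -/

import Mathlib

universe w v u

open CategoryTheory CategoryTheory.Limits
open scoped TensorProduct

noncomputable section

namespace LinCat

section TwoVectorSpaces

/-- The isomorphism classes of simple objects of a category. -/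
def SimpleClasses (C : Type u) [Category.{v} C] [HasZeroMorphisms C] : Type u :=
  {c : Quotient (isIsomorphicSetoid C) // ∃ X : C, Simple X ∧ Quotient.mk _ X = c}

/-- The dimension of a 2-vector space: the number of isomorphism classes of simple objects. -/
def Dim (C : Type u) [Category.{v} C] [HasZeroMorphisms C] : ℕ :=
  Nat.card (SimpleClasses C)

/-- 2-vector spaces over `k`: semisimple abelian `k`-linear categories with finitely many
isomorphism classes of simple objects and finite-dimensional `Hom`-spaces.
The inherited classes say that `C` is abelian (for the given preadditive structure). -/
class IsTwoVectorSpace (k : Type w) [Field k] (C : Type u) [Category.{v} C] [Preadditive C]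
    [Linear k C] : Prop
    extends HasFiniteBiproducts C, HasKernels C, HasCokernels C,
      IsNormalMonoCategory C, IsNormalEpiCategory C where
  /-- every object is a finite direct sum of simple objects -/
  semisimple : ∀ X : C, ∃ (m : ℕ) (S : Fin m → C), (∀ i, Simple (S i)) ∧ Nonempty (X ≅ ⨁ S)
  finite_simples : Finite (SimpleClasses C)
  finite_hom : ∀ X Y : C, Module.Finite k (X ⟶ Y)

end TwoVectorSpaces

section TensorPowers

/-- Formal tensor products `⊠ i, V i` of objects of `C`, indexed by `ι`; the field `k` is a
parameter because morphisms are tensors over `k`. -/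
structure TensorTuple (k : Type w) (C : Type u) (ι : Type) where
  /-- the factors -/
  obj : ι → C

variable {k : Type w} [Field k] {C : Type u} [Category.{v} C] [Preadditive C] [Linear k C]
variable {ι : Type}

instance TensorTuple.category : Category.{max w v} (TensorTuple k C ι) where
  Hom X Y := ⨂[k] i, (X.obj i ⟶ Y.obj i)
  id X := PiTensorProduct.tprod k fun i => 𝟙 (X.obj i)
  comp {X Y Z} f g :=
    PiTensorProduct.map₂ (fun i => Linear.comp (S := k) (X.obj i) (Y.obj i) (Z.obj i)) f g
  id_comp {X Y} f := by
    induction f using PiTensorProduct.induction_on with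
    | smul_tprod r f => simp [PiTensorProduct.map₂_tprod_tprod]
    | add f g hf hg => rw [map_add, hf, hg]
  comp_id {X Y} f := by
    induction f using PiTensorProduct.induction_on with
    | smul_tprod r f => simp [PiTensorProduct.map₂_tprod_tprod]
    | add f g hf hg => rw [map_add, LinearMap.add_apply, hf, hg]
  assoc {W X Y Z} f g h := by
    induction f using PiTensorProduct.induction_on with
    | add f f' hf hf' => simp only [map_add, LinearMap.add_apply, hf, hf']
    | smul_tprod r f =>
      induction g using PiTensorProduct.induction_on with
      | add g g' hg hg' => simp only [map_add, LinearMap.add_apply, hg, hg']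
      | smul_tprod s g =>
        induction h using PiTensorProduct.induction_on with
        | add h h' hh hh' => simp only [map_add, hh, hh']
        | smul_tprod t h => simp [PiTensorProduct.map₂_tprod_tprod]

theorem TensorTuple.comp_def {X Y Z : TensorTuple k C ι} (f : X ⟶ Y) (g : Y ⟶ Z) :
    f ≫ g = PiTensorProduct.map₂
      (fun i => Linear.comp (S := k) (X.obj i) (Y.obj i) (Z.obj i)) f g := rfl

instance : Preadditive (TensorTuple k C ι) where
  homGroup X Y := inferInstanceAs (AddCommGroup (⨂[k] i, (X.obj i ⟶ Y.obj i)))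
  add_comp X Y Z f f' g := LinearMap.map_add₂ (PiTensorProduct.map₂
    (fun i => Linear.comp (S := k) (X.obj i) (Y.obj i) (Z.obj i))) f f' g
  comp_add X Y Z f g g' := LinearMap.map_add (PiTensorProduct.map₂
    (fun i => Linear.comp (S := k) (X.obj i) (Y.obj i) (Z.obj i)) f) g g'

instance : Linear k (TensorTuple k C ι) where
  homModule X Y := inferInstanceAs (Module k (⨂[k] i, (X.obj i ⟶ Y.obj i)))
  smul_comp X Y Z r f g := LinearMap.map_smul₂ (PiTensorProduct.map₂
    (fun i => Linear.comp (S := k) (X.obj i) (Y.obj i) (Z.obj i))) r f g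
  comp_smul X Y Z f r g := LinearMap.map_smul (PiTensorProduct.map₂
    (fun i => Linear.comp (S := k) (X.obj i) (Y.obj i) (Z.obj i)) f) r g

/-- Permutation of the factors:
`σ (⊠ i, V i) = ⊠ i, V (σ⁻¹ i)`. -/
def TensorTuple.perm (σ : Equiv.Perm ι) : TensorTuple k C ι ⥤ TensorTuple k C ι where
  obj X := ⟨fun i => X.obj (σ.symm i)⟩
  map {X Y} f := PiTensorProduct.reindex k (fun i => (X.obj i ⟶ Y.obj i)) σ f
  map_id X := PiTensorProduct.reindex_tprod (R := k) σ _
  map_comp {X Y Z} f g := by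
    simp only [TensorTuple.comp_def]
    induction f using PiTensorProduct.induction_on with
    | add f f' hf hf' => simp only [map_add, LinearMap.add_apply, hf, hf']
    | smul_tprod r f =>
      induction g using PiTensorProduct.induction_on with
      | add g g' hg hg' => simp only [map_add, hg, hg']
      | smul_tprod s g => simp [PiTensorProduct.map₂_tprod_tprod]

instance (σ : Equiv.Perm ι) : (TensorTuple.perm (k := k) (C := C) σ).Additive where
  map_add {X Y f g} := map_add (PiTensorProduct.reindex k (fun i => (X.obj i ⟶ Y.obj i)) σ) f g

instance (σ : Equiv.Perm ι) : (TensorTuple.perm (k := k) (C := C) σ).Linear k where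
  map_smul {X Y} f r :=
    map_smul (PiTensorProduct.reindex k (fun i => (X.obj i ⟶ Y.obj i)) σ) r f

end TensorPowers

section MatLinear

variable {k : Type w} [Field k] {D : Type u} [Category.{v} D] [Preadditive D] [Linear k D]

instance : Linear k (Mat_ D) where
  homModule M N := inferInstanceAs (Module k (∀ (i : M.ι) (j : N.ι), M.X i ⟶ N.X j))
  smul_comp M N K r f g := by
    ext i j
    change ∑ l, (r • f i l) ≫ g l j = r • ∑ l, f i l ≫ g l j
    simp [Finset.smul_sum]
  comp_smul M N K f r g := by
    ext i j
    change ∑ l, f i l ≫ (r • g l j) = r • ∑ l, f i l ≫ g l j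
    simp [Finset.smul_sum]

instance (F : D ⥤ D) [F.Additive] : F.mapMat_.Additive where
  map_add {M N f g} := by
    ext i j
    exact F.map_add

instance (F : D ⥤ D) [F.Additive] [F.Linear k] : F.mapMat_.Linear k where
  map_smul {M N} f r := by
    ext i j
    exact F.map_smul r (f i j)

end MatLinear

section TwoRepresentations

variable (k : Type w) [Field k] (G : Type) [Group G]
variable (C : Type u) [Category.{v} C] [Preadditive C] [Linear k C]

/-- A 2-representation of `G` on `C`: an action of `G` on `C` by linear functors. -/
structure TwoRep where
  /-- the functor by which `g` acts -/
  ρ : G → C ⥤ C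
  additive : ∀ g, (ρ g).Additive
  linear : ∀ g, (ρ g).Linear k
  /-- the isomorphism `ρ g ∘ ρ h ≅ ρ (g h)` -/
  φ : ∀ g h, ρ h ⋙ ρ g ≅ ρ (g * h)
  /-- the isomorphism `ρ 1 ≅ id` -/
  φ₁ : ρ 1 ≅ 𝟭 C
  assoc : ∀ g h l X,
    (φ g h).hom.app ((ρ l).obj X) ≫ (φ (g * h) l).hom.app X =
      (ρ g).map ((φ h l).hom.app X) ≫ (φ g (h * l)).hom.app X ≫
        eqToHom (by rw [mul_assoc])
  one_left : ∀ g X,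
    (φ 1 g).hom.app X = φ₁.hom.app ((ρ g).obj X) ≫ eqToHom (by rw [one_mul]; rfl)
  one_right : ∀ g X,
    (φ g 1).hom.app X = (ρ g).map (φ₁.hom.app X) ≫ eqToHom (by rw [mul_one]; rfl)

variable {k G C}

/-- `G`-equivariant objects for a 2-representation. -/
structure Equivariant (R : TwoRep k G C) where
  /-- the underlying object -/
  V : C
  /-- the structure isomorphisms -/
  ε : ∀ g, V ≅ (R.ρ g).obj V
  compat : ∀ g h,
    (ε g).hom ≫ (R.ρ g).map (ε h).hom ≫ (R.φ g h).hom.app V = (ε (g * h)).hom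

variable {R : TwoRep k G C}

/-- Equivariant morphisms: those that commute with the structure isomorphisms. -/
def Equivariant.homs (A B : Equivariant R) : Submodule k (A.V ⟶ B.V) where
  carrier := {f | ∀ g, f ≫ (B.ε g).hom = (A.ε g).hom ≫ (R.ρ g).map f}
  zero_mem' g := by
    have := R.additive g
    simp
  add_mem' {f f'} hf hf' g := by
    have := R.additive g
    simp [hf g, hf' g]
  smul_mem' r f hf g := by
    have := R.linear g
    simp [hf g]

instance Equivariant.category : Category.{v} (Equivariant R) where
  Hom A B := A.homs B
  id A := ⟨𝟙 A.V, fun g => by simp⟩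
  comp {A B D} f f' := ⟨f.1 ≫ f'.1, fun g => by
    rw [Category.assoc, f'.2 g, ← Category.assoc, f.2 g, Category.assoc, Functor.map_comp]⟩

instance : Preadditive (Equivariant R) where
  homGroup A B := inferInstanceAs (AddCommGroup (A.homs B))
  add_comp _ _ _ _ _ _ := Subtype.ext (Preadditive.add_comp _ _ _ _ _ _)
  comp_add _ _ _ _ _ _ := Subtype.ext (Preadditive.comp_add _ _ _ _ _ _)

instance : Linear k (Equivariant R) where
  homModule A B := inferInstanceAs (Module k (A.homs B))
  smul_comp _ _ _ _ _ _ := Subtype.ext (Linear.smul_comp _ _ _ _ _ _)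
  comp_smul _ _ _ _ _ _ := Subtype.ext (Linear.comp_smul _ _ _ _ _ _)

end TwoRepresentations

section SymmetricPowers

variable (k : Type w) [Field k] (C : Type u) [Category.{v} C] [Preadditive C] [Linear k C]

/-- The tensor power `C ⊠ ⋯ ⊠ C` (`n` factors): objects are formal finite direct sums of formal
tensor products `V₁ ⊠ ⋯ ⊠ Vₙ`, morphisms are matrices with entries in
`⨂ i, Hom (V i) (W i)`. -/
abbrev TensorPower (n : ℕ) := Mat_ (TensorTuple k C (Fin n))

theorem perm_map_map {ι : Type} (σ τ : Equiv.Perm ι) {X Y : TensorTuple k C ι} (f : X ⟶ Y) :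
    (TensorTuple.perm σ).map ((TensorTuple.perm τ).map f) =
      (TensorTuple.perm (σ * τ)).map f :=
  PiTensorProduct.reindex_reindex (R := k) τ σ f

theorem perm_one_map {ι : Type} {X Y : TensorTuple k C ι} (f : X ⟶ Y) :
    (TensorTuple.perm 1).map f = f :=
  congrArg (fun e => e f) (PiTensorProduct.reindex_refl (R := k)
    (s := fun i => (X.obj i ⟶ Y.obj i)))

/-- The action of the symmetric group on the tensor power by permutation of the factors in each
summand; the isomorphisms `φ` and `φ₁` are identities. -/
def permRep (n : ℕ) : TwoRep k (Equiv.Perm (Fin n)) (TensorPower k C n) where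
  ρ σ := (TensorTuple.perm σ).mapMat_
  additive σ := inferInstance
  linear σ := inferInstance
  φ σ τ := NatIso.ofComponents (fun M => Iso.refl _) fun {M N} f => by
    refine (Category.comp_id _).trans (Eq.trans ?_ (Category.id_comp _).symm)
    ext i j
    exact perm_map_map k C σ τ (f i j)
  φ₁ := NatIso.ofComponents (fun M => Iso.refl _) fun {M N} f => by
    refine (Category.comp_id _).trans (Eq.trans ?_ (Category.id_comp _).symm)
    ext i j
    exact perm_one_map k C (f i j)
  assoc σ τ υ M := by
    change 𝟙 _ ≫ 𝟙 _ = (TensorTuple.perm σ).mapMat_.map (𝟙 _) ≫ 𝟙 _ ≫ 𝟙 _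
    rw [CategoryTheory.Functor.map_id]
    simp only [Category.comp_id]
  one_left σ M := by
    change 𝟙 _ = 𝟙 _ ≫ 𝟙 _
    exact (Category.id_comp _).symm
  one_right σ M := by
    change 𝟙 _ = (TensorTuple.perm σ).mapMat_.map (𝟙 _) ≫ 𝟙 _
    rw [CategoryTheory.Functor.map_id]
    exact (Category.id_comp _).symm

/-- The `n`th symmetric power: `Sₙ`-equivariant objects in the `n`th tensor power. -/
abbrev SymPower (n : ℕ) := Equivariant (permRep k C n)

end SymmetricPowers

open scoped PowerSeries.WithPiTopology in
/-- The Euler function `φ(q) = ∏_{n ≥ 1} (1 - q ^ n)`, as a formal power series. -/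
def eulerFunction : PowerSeries ℤ := ∏' n : ℕ, (1 - PowerSeries.X ^ (n + 1))

open scoped PowerSeries.WithPiTopology in
/-- The infinite product defining the Euler function converges. -/
theorem hasProd_eulerFunction :
    HasProd (fun n : ℕ => (1 - PowerSeries.X ^ (n + 1) : PowerSeries ℤ)) eulerFunction :=
  (PowerSeries.WithPiTopology.hasProd_one_sub_X_pow (R := ℤ)).multipliable.hasProd

end LinCat

end

/-! Let `S i`, `i ∈ I`, represent the simple objects of `V`, so that `I` has `d` elements. The
formal tensor products of the `S i` along colourings `x : Fin n → I` are pairwise orthogonal with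
endomorphism ring `k`, and every identity in the tensor power factors through sums of them
(`IsSchurFamily.tuple`, `IsSchurFamily.mat`). Linear algebra on multiplicity spaces then gives every
morphism `f` a quasi-inverse `g`, `f ≫ g ≫ f = f`. In characteristic 0, averaging `g` over `Sₙ`
carries this over to equivariant objects (`Equivariant.isRegular`); together with split idempotents
and finite-dimensional Hom spaces it makes the symmetric power abelian and semisimple.

The simple objects are counted by computing a centre in two ways. Let `P x` be the equivariant
object induced from the tensor product at the colouring `x`. Every simple object receives a nonzero
map from some `P x`, so by Schur's lemma the centre of the full subcategory on the `P x` is the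
space of functions on the simple classes (`scalarFamilyEquiv`); the `P x` need be neither simple nor
pairwise non-isomorphic. On the other hand, the morphisms `P x ⟶ P y` have a basis indexed by the
`g` with `g • y = x`, which compose as in the group (`inducedActionBasis`), so the dimension of the
centre is the number of conjugacy classes of pairs `(x, g)` with `g • x = x` (`loopFamilyEquiv`).
Such a pair is a permutation preserving each colour class, and its class is given by one cycle type
per colour (`Loop.conj_iff`). The dimension is thus the coefficient of `q ^ n` in `(∑ p(m) q ^ m) ^
d`, and Euler's product identifies `∑ p(m) q ^ m` with the inverse of `φ(q)`.

If there is only one simple object, with tensor power `T`, then `M ↦ Hom(T, M)` with the conjugation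
action is an equivalence onto the representations of `Sₙ`. -/

noncomputable section

namespace LinCat

/-! ### Von Neumann regular categories: abelianness and semisimplicity -/

section Regular

variable {C : Type u} [Category.{v} C] [Preadditive C]

variable (C) in
/-- Every morphism `f` has a quasi-inverse `g`, that is, `f ≫ g ≫ f = f`. -/
def IsRegular : Prop := ∀ ⦃X Y : C⦄ (f : X ⟶ Y), ∃ g : Y ⟶ X, f ≫ g ≫ f = f

/-- The morphism `𝟙 X - f ≫ g` is idempotent, is killed by `f`, and fixes every `h` with `h ≫ f =
0`. Hence its image is the kernel of `f`. Cokernels are dual, with `𝟙 Y - g ≫ f`. -/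
theorem IsRegular.hasKernels (hC : IsRegular C) [IsIdempotentComplete C] : HasKernels C where
  has_limit {X Y} f := by
    obtain ⟨g, hg⟩ := hC f
    obtain ⟨Z, i, p, hip, hpi⟩ := IsIdempotentComplete.idempotents_split X (𝟙 X - f ≫ g)
      (by simp only [Preadditive.comp_sub, Preadditive.sub_comp, Category.assoc, Category.id_comp,
        Category.comp_id, reassoc_of% hg, sub_self, sub_zero])
    have hi : i ≫ f = 0 := by
      have : i ≫ f = (i ≫ p ≫ i) ≫ f := by rw [reassoc_of% hip]
      rw [this, hpi]
      simp [hg]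
    exact ⟨⟨⟨KernelFork.ofι i hi, KernelFork.IsLimit.ofι i hi (fun h _ => h ≫ p)
      (fun h hh => by rw [Category.assoc, hpi]; simp [reassoc_of% hh])
      (fun h hh m hm => by rw [← hm, Category.assoc, hip, Category.comp_id])⟩⟩⟩

theorem IsRegular.hasCokernels (hC : IsRegular C) [IsIdempotentComplete C] : HasCokernels C where
  has_colimit {X Y} f := by
    obtain ⟨g, hg⟩ := hC f
    obtain ⟨Z, i, p, hip, hpi⟩ := IsIdempotentComplete.idempotents_split Y (𝟙 Y - g ≫ f)
      (by simp only [Preadditive.comp_sub, Preadditive.sub_comp, Category.assoc, Category.id_comp,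
        Category.comp_id, hg, sub_self, sub_zero])
    have hp : f ≫ p = 0 := by
      have : f ≫ p = f ≫ (p ≫ i) ≫ p := by rw [Category.assoc, hip, Category.comp_id]
      rw [this, hpi]
      simp [reassoc_of% hg]
    exact ⟨⟨⟨CokernelCofork.ofπ p hp, CokernelCofork.IsColimit.ofπ p hp (fun h _ => i ≫ h)
      (fun h hh => by rw [← Category.assoc, hpi]; simp [hh])
      (fun h hh m hm => by rw [← hm, ← Category.assoc, hip, Category.id_comp])⟩⟩⟩

/-- Cancelling the monomorphism in `f ≫ g ≫ f = f` shows that `f` is split, and a split monomorphism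
is the kernel of the complementary idempotent. -/
theorem IsRegular.isNormalMonoCategory (hC : IsRegular C) : IsNormalMonoCategory C where
  normalMonoOfMono {X Y} f _ := by
    obtain ⟨g, hg⟩ := hC f
    have h1 : f ≫ g = 𝟙 X := by rw [← cancel_mono f]; simpa using hg
    exact ⟨{  Z := Y
              g := 𝟙 Y - g ≫ f
              w := by simp [hg]
              isLimit := KernelFork.IsLimit.ofι f _ (fun h _ => h ≫ g)
                (fun h hh => by
                  rw [Preadditive.comp_sub, Category.comp_id, sub_eq_zero] at hh
                  rw [Category.assoc, ← hh])
                (fun h hh m hm => by rw [← hm, Category.assoc, h1, Category.comp_id]) }⟩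

theorem IsRegular.isNormalEpiCategory (hC : IsRegular C) : IsNormalEpiCategory C where
  normalEpiOfEpi {X Y} f _ := by
    obtain ⟨g, hg⟩ := hC f
    have h1 : g ≫ f = 𝟙 Y := by rw [← cancel_epi f]; simpa using hg
    exact ⟨{  W := X
              g := 𝟙 X - f ≫ g
              w := by simp [hg]
              isColimit := CokernelCofork.IsColimit.ofπ f _ (fun h _ => g ≫ h)
                (fun h hh => by
                  rw [Preadditive.sub_comp, Category.id_comp, sub_eq_zero, Category.assoc] at hh
                  rw [← hh])
                (fun h hh m hm => by rw [← hm, ← Category.assoc, h1, Category.id_comp]) }⟩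

/-- A presentation of an object as a finite direct sum of simple objects. -/
structure SimpleDecomposition (X : C) where
  /-- the index type of the summands -/
  J : Type
  [fintype : Fintype J]
  /-- the summands -/
  S : J → C
  simple : ∀ j, Simple (S j)
  /-- the projections -/
  π : ∀ j, X ⟶ S j
  /-- the inclusions -/
  ι : ∀ j, S j ⟶ X
  ι_π_self : ∀ j, ι j ≫ π j = 𝟙 (S j)
  ι_π_ne : ∀ i j, i ≠ j → ι i ≫ π j = 0
  total : ∑ j, π j ≫ ι j = 𝟙 X

attribute [instance] SimpleDecomposition.fintype

/-- The direct sum of two decompositions. -/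
def SimpleDecomposition.add {X Y Z : C} (DY : SimpleDecomposition Y) (DZ : SimpleDecomposition Z)
    (i : Y ⟶ X) (p : X ⟶ Y) (i' : Z ⟶ X) (p' : X ⟶ Z) (hip : i ≫ p = 𝟙 Y) (hip' : i' ≫ p' = 𝟙 Z)
    (h : i ≫ p' = 0) (h' : i' ≫ p = 0) (ht : p ≫ i + p' ≫ i' = 𝟙 X) : SimpleDecomposition X where
  J := DY.J ⊕ DZ.J
  S := Sum.elim DY.S DZ.S
  simple := by rintro (j | j); exacts [DY.simple j, DZ.simple j]
  π := fun j => match j with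
    | .inl j => p ≫ DY.π j
    | .inr j => p' ≫ DZ.π j
  ι := fun j => match j with
    | .inl j => DY.ι j ≫ i
    | .inr j => DZ.ι j ≫ i'
  ι_π_self := by
    rintro (j | j)
    · simp [reassoc_of% hip, DY.ι_π_self]
    · simp [reassoc_of% hip', DZ.ι_π_self]
  ι_π_ne := by
    rintro (j | j) (j' | j') hj
    · change (DY.ι j ≫ i) ≫ p ≫ DY.π j' = 0
      rw [Category.assoc, reassoc_of% hip, DY.ι_π_ne j j' (fun h => hj (by rw [h]))]
    · change (DY.ι j ≫ i) ≫ p' ≫ DZ.π j' = 0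
      rw [Category.assoc, reassoc_of% h, zero_comp, comp_zero]
    · change (DZ.ι j ≫ i') ≫ p ≫ DY.π j' = 0
      rw [Category.assoc, reassoc_of% h', zero_comp, comp_zero]
    · change (DZ.ι j ≫ i') ≫ p' ≫ DZ.π j' = 0
      rw [Category.assoc, reassoc_of% hip', DZ.ι_π_ne j j' (fun h => hj (by rw [h]))]
  total := by
    rw [Fintype.sum_sum_type]
    change ∑ j, (p ≫ DY.π j) ≫ DY.ι j ≫ i + ∑ j, (p' ≫ DZ.π j) ≫ DZ.ι j ≫ i' = 𝟙 X
    have h1 (j) : (p ≫ DY.π j) ≫ DY.ι j ≫ i = p ≫ (DY.π j ≫ DY.ι j) ≫ i := by simp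
    have h2 (j) : (p' ≫ DZ.π j) ≫ DZ.ι j ≫ i' = p' ≫ (DZ.π j ≫ DZ.ι j) ≫ i' := by simp
    simp only [h1, h2, ← Preadditive.comp_sum, ← Preadditive.sum_comp, DY.total, DZ.total,
      Category.id_comp, ht]

theorem SimpleDecomposition.exists_iso {X : C} [HasFiniteBiproducts C]
    (D : SimpleDecomposition X) :
    ∃ (m : ℕ) (S : Fin m → C), (∀ i, Simple (S i)) ∧ Nonempty (X ≅ ⨁ S) := by
  classical
  let e := Fintype.equivFin D.J
  refine ⟨_, D.S ∘ e.symm, fun i => D.simple _, ⟨?_⟩⟩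
  let b : Bicone (D.S ∘ e.symm) :=
    { pt := X
      π := fun i => D.π (e.symm i)
      ι := fun i => D.ι (e.symm i)
      ι_π := ?_ }
  refine biproduct.uniqueUpToIso _ (b := b) (isBilimitOfTotal _ ?_)
  · rw [← D.total]
    exact e.symm.sum_comp (fun j => D.π j ≫ D.ι j)
  · intro i j
    split_ifs with h
    · subst h; simp [D.ι_π_self]
    · exact D.ι_π_ne _ _ (fun h' => h (e.symm.injective h'))

variable (k : Type w) [Field k] [Linear k C]

/-- The map `a ↦ p ≫ a ≫ i` embeds `End Y` into `End X`. If it hit `𝟙 X = p ≫ a ≫ i`, composing with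
`i` would give `a ≫ i = i`, hence `p ≫ i = 𝟙 X`. -/
theorem finrank_end_lt [∀ X Y : C, Module.Finite k (X ⟶ Y)] {X Y : C} (i : Y ⟶ X) (p : X ⟶ Y)
    (hip : i ≫ p = 𝟙 Y) (hpi : p ≫ i ≠ 𝟙 X) :
    Module.finrank k (Y ⟶ Y) < Module.finrank k (X ⟶ X) := by
  let L : (Y ⟶ Y) →ₗ[k] (X ⟶ X) :=
    { toFun := fun a => p ≫ a ≫ i
      map_add' := by simp
      map_smul' := by simp }
  have hL : Function.Injective L := fun a b h => by
    have := congrArg (fun z => i ≫ z ≫ p) h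
    simpa [L, reassoc_of% hip, hip] using this
  rw [← LinearMap.finrank_range_of_inj hL]
  refine Submodule.finrank_lt fun h => hpi ?_
  obtain ⟨a, ha⟩ := LinearMap.range_eq_top.mp h (𝟙 X)
  have hai : a ≫ i = i := by
    have := congrArg (fun z => i ≫ z) ha
    simpa [L, reassoc_of% hip] using this
  have : p ≫ a ≫ i = 𝟙 X := ha
  rwa [hai] at this

/-- Induction on `dim End X`: a nonzero object that is not simple has a proper nonzero subobject,
which regularity splits off, and both summands have smaller endomorphism spaces. -/
theorem IsRegular.exists_simpleDecomposition (hC : IsRegular C) [IsIdempotentComplete C]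
    [∀ X Y : C, Module.Finite k (X ⟶ Y)] (X : C) : Nonempty (SimpleDecomposition X) := by
  generalize hN : Module.finrank k (X ⟶ X) = N
  induction N using Nat.strong_induction_on generalizing X with
  | _ N ih =>
  subst hN
  by_cases h0 : 𝟙 X = 0
  · exact ⟨{ J := Empty, S := Empty.elim, simple := fun j => j.elim, π := fun j => j.elim,
             ι := fun j => j.elim, ι_π_self := fun j => j.elim, ι_π_ne := fun j => j.elim,
             total := by simp [h0] }⟩
  by_cases hs : Simple X
  · exact ⟨{ J := Unit, S := fun _ => X, simple := fun _ => hs, π := fun _ => 𝟙 X,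
             ι := fun _ => 𝟙 X, ι_π_self := by simp,
             ι_π_ne := fun i j h => (h (Subsingleton.elim _ _)).elim, total := by simp }⟩
  obtain ⟨Y, f, hf, hf0, hfi⟩ : ∃ (Y : C) (f : Y ⟶ X), Mono f ∧ f ≠ 0 ∧ ¬ IsIso f := by
    by_contra! H
    refine hs ⟨fun {Y} f _ => ⟨fun hi hf => h0 ?_, fun h => H Y f inferInstance h⟩⟩
    simpa [hf] using (IsIso.inv_hom_id f).symm
  obtain ⟨g, hg⟩ := hC f
  have hfg : f ≫ g = 𝟙 Y := by rw [← cancel_mono f]; simpa using hg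
  have hgf : g ≫ f ≠ 𝟙 X := fun h => hfi ⟨g, hfg, h⟩
  obtain ⟨Z, i, p, hip, hpi⟩ := IsIdempotentComplete.idempotents_split X (𝟙 X - g ≫ f)
      (by simp only [Preadditive.comp_sub, Preadditive.sub_comp, Category.assoc, Category.id_comp,
        Category.comp_id, hg, sub_self, sub_zero])
  -- The complement is proper: otherwise `g ≫ f = 0`, and then `f = f ≫ g ≫ f = 0`.
  have hpi' : p ≫ i ≠ 𝟙 X := by
    rw [hpi]
    intro h
    rw [sub_eq_self] at h
    apply hf0
    rw [← Category.id_comp f, ← hfg, Category.assoc, h, comp_zero]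
  obtain ⟨DY⟩ := ih _ (finrank_end_lt k f g hfg hgf) Y rfl
  obtain ⟨DZ⟩ := ih _ (finrank_end_lt k i p hip hpi') Z rfl
  have h1 : f ≫ p = 0 := by
    have : f ≫ p = f ≫ (p ≫ i) ≫ p := by rw [Category.assoc, hip, Category.comp_id]
    rw [this, hpi]
    simp [reassoc_of% hg]
  have h2 : i ≫ g = 0 := by
    have : i ≫ g = i ≫ (p ≫ i) ≫ g := by rw [Category.assoc, reassoc_of% hip]
    rw [this, hpi]
    simp [hfg]
  exact ⟨DY.add DZ f g i p hfg hip h1 h2 (by rw [hpi]; abel)⟩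

end Regular

/-! ### The centre of a detecting family and the number of simple classes -/

section Center

variable {C : Type u} [Category.{v} C] [Preadditive C]
variable (k : Type w) [Field k] [Linear k C]

/-- Compatible families of endomorphisms of the objects `P x`: the centre of the full subcategory
on these objects. -/
def familyCenter {X : Type} (P : X → C) : Submodule k (∀ x, P x ⟶ P x) where
  carrier := {z | ∀ x y (f : P x ⟶ P y), f ≫ z y = z x ≫ f}
  zero_mem' x y f := by simp
  add_mem' hz hz' x y f := by simp [hz x y f, hz' x y f]
  smul_mem' r z hz x y f := by simp [hz x y f]

/-- The class of a simple object. -/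
def simpleClass (S : C) (hS : Simple S) : SimpleClasses C := ⟨Quotient.mk _ S, S, hS, rfl⟩

theorem simpleClass_eq_iff {S T : C} (hS : Simple S) (hT : Simple T) :
    simpleClass S hS = simpleClass T hT ↔ Nonempty (S ≅ T) :=
  Subtype.ext_iff.trans Quotient.eq

theorem exists_simpleClass_eq (c : SimpleClasses C) : ∃ S hS, simpleClass (C := C) S hS = c := by
  obtain ⟨c, S, hS, h⟩ := c
  exact ⟨S, hS, Subtype.ext h⟩

/-- A family of objects is detecting if every simple object receives a nonzero map from it. -/
def Detects {X : Type} (P : X → C) : Prop :=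
  ∀ S : C, Simple S → ∃ x, ∃ f : P x ⟶ S, f ≠ 0

variable [HasKernels C] {X : Type} {P : X → C} (D : ∀ x, SimpleDecomposition (P x))

-- A nonzero map from `P x` to a simple object is nonzero on some simple summand of `P x`, where it
-- is an isomorphism by Schur's lemma.
include D in
theorem Detects.exists_simpleClass_eq (hP : Detects P) (c : SimpleClasses C) :
    ∃ x j, simpleClass ((D x).S j) ((D x).simple j) = c := by
  obtain ⟨S, hS, rfl⟩ := LinCat.exists_simpleClass_eq c
  obtain ⟨x, f, hf⟩ := hP S hS
  by_contra! H
  refine hf ?_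
  rw [← Category.id_comp f, ← (D x).total, Preadditive.sum_comp]
  refine Finset.sum_eq_zero fun j _ => ?_
  have := (D x).simple j
  by_contra h
  have h' : (D x).ι j ≫ f ≠ 0 := fun h0 => h (by rw [Category.assoc, h0, comp_zero])
  have := isIso_of_hom_simple h'
  exact H x j ((simpleClass_eq_iff _ _).2 ⟨asIso ((D x).ι j ≫ f)⟩)

/-- A function on the simple classes acts on each object by scalars on its simple summands. -/
def scalarFamily : (SimpleClasses C → k) →ₗ[k] ∀ x, P x ⟶ P x where
  toFun c x := ∑ j, c (simpleClass ((D x).S j) ((D x).simple j)) • ((D x).π j ≫ (D x).ι j)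
  map_add' c c' := by
    ext x
    simp [add_smul, Finset.sum_add_distrib]
  map_smul' r c := by
    ext x
    simp [mul_smul, Finset.smul_sum]

omit [HasKernels C] in
theorem ι_scalarFamily (c : SimpleClasses C → k) (x : X) (j : (D x).J) :
    (D x).ι j ≫ scalarFamily k D c x =
      c (simpleClass ((D x).S j) ((D x).simple j)) • (D x).ι j := by
  simp only [scalarFamily, LinearMap.coe_mk, AddHom.coe_mk, Preadditive.comp_sum]
  rw [Finset.sum_eq_single j]
  · simp [reassoc_of% (D x).ι_π_self]
  · intro i _ hi
    simp [reassoc_of% (D x).ι_π_ne j i hi.symm]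
  · simp

omit [HasKernels C] in
theorem scalarFamily_π (c : SimpleClasses C → k) (x : X) (j : (D x).J) :
    scalarFamily k D c x ≫ (D x).π j =
      c (simpleClass ((D x).S j) ((D x).simple j)) • (D x).π j := by
  simp only [scalarFamily, LinearMap.coe_mk, AddHom.coe_mk, Preadditive.sum_comp]
  rw [Finset.sum_eq_single j]
  · simp [(D x).ι_π_self]
  · intro i _ hi
    simp [(D x).ι_π_ne i j hi]
  · simp

/-- Each component of `f` between simple summands is zero or an isomorphism; in the second case the
two summands have the same class, hence the same scalar. -/
theorem scalarFamily_mem (c : SimpleClasses C → k) : scalarFamily k D c ∈ familyCenter k P := by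
  intro x y f
  rw [← Category.id_comp f, ← (D x).total, ← Category.comp_id f, ← (D y).total]
  simp only [Preadditive.sum_comp, Preadditive.comp_sum, Category.assoc]
  refine Finset.sum_congr rfl fun j _ => Finset.sum_congr rfl fun i _ => ?_
  rw [ι_scalarFamily, reassoc_of% scalarFamily_π]
  simp only [Linear.comp_smul, Linear.smul_comp]
  by_cases h : (D x).ι i ≫ f ≫ (D y).π j = 0
  · have h1 : (D x).π i ≫ (D x).ι i ≫ f ≫ (D y).π j ≫ (D y).ι j = 0 := by
      have := congrArg (fun z => (D x).π i ≫ z ≫ (D y).ι j) h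
      simpa using this
    rw [h1, smul_zero, smul_zero]
  · have := (D x).simple i
    have := (D y).simple j
    have := isIso_of_hom_simple h
    rw [(simpleClass_eq_iff ((D x).simple i) ((D y).simple j)).2
      ⟨asIso ((D x).ι i ≫ f ≫ (D y).π j)⟩]

omit [HasKernels C] in
theorem scalarFamily_injective
    (hD : ∀ c : SimpleClasses C, ∃ x j, simpleClass ((D x).S j) ((D x).simple j) = c) :
    Function.Injective (scalarFamily k D) := by
  rw [injective_iff_map_eq_zero]
  intro c hc
  ext s
  obtain ⟨x, j, rfl⟩ := hD s
  have h := ι_scalarFamily k D c x j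
  rw [hc, Pi.zero_apply, comp_zero] at h
  have h2 := congrArg (fun z => z ≫ (D x).π j) h
  simp only [zero_comp, Linear.smul_comp, (D x).ι_π_self] at h2
  have := (D x).simple j
  exact (smul_eq_zero.mp h2.symm).resolve_right (id_nonzero _)

variable [IsAlgClosed k] [∀ X Y : C, Module.Finite k (X ⟶ Y)]

/-- Since `k` is algebraically closed, `z` has scalar diagonal components. Commutation with a map
that factors through an isomorphism of two summands makes the scalar depend only on the class;
commutation with the projectors excludes off-diagonal components. -/
theorem exists_scalarFamily_eq
    (hD : ∀ c : SimpleClasses C, ∃ x j, simpleClass ((D x).S j) ((D x).simple j) = c)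
    (z : ∀ x, P x ⟶ P x) (hz : z ∈ familyCenter k P) : ∃ c, scalarFamily k D c = z := by
  have hs (x) (j : (D x).J) : ∃ r : k, (D x).ι j ≫ z x ≫ (D x).π j = r • 𝟙 _ := by
    have := (D x).simple j
    obtain ⟨r, hr⟩ := endomorphism_simple_eq_smul_id k ((D x).ι j ≫ z x ≫ (D x).π j)
    exact ⟨r, hr.symm⟩
  choose r hr using hs
  have hr' (x y) (i : (D x).J) (j : (D y).J)
      (h : simpleClass ((D x).S i) ((D x).simple i) = simpleClass ((D y).S j) ((D y).simple j)) :
      r x i = r y j := by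
    obtain ⟨e⟩ := (simpleClass_eq_iff _ _).1 h
    have h1 := congrArg (fun t => (D x).ι i ≫ t ≫ (D y).π j)
      (hz x y ((D x).π i ≫ e.hom ≫ (D y).ι j))
    simp only [Category.assoc, hr, Linear.comp_smul, Category.comp_id, (D y).ι_π_self] at h1
    rw [← Category.assoc ((D x).ι i), (D x).ι_π_self, Category.id_comp] at h1
    have h2 : (D x).ι i ≫ z x ≫ (D x).π i ≫ e.hom = r x i • e.hom := by
      have := congrArg (fun t => t ≫ e.hom) (hr x i)
      simpa using this
    rw [h2] at h1
    have h3 := congrArg (fun t => t ≫ e.inv) h1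
    simp only [Linear.smul_comp, Iso.hom_inv_id] at h3
    have := (D x).simple i
    exact (smul_left_injective k (id_nonzero ((D x).S i)) h3).symm
  choose X' J' hXJ using hD
  refine ⟨fun c => r (X' c) (J' c), ?_⟩
  ext x
  rw [← Category.id_comp (scalarFamily k D _ x), ← Category.id_comp (z x), ← (D x).total,
    Preadditive.sum_comp, Preadditive.sum_comp]
  refine Finset.sum_congr rfl fun j _ => ?_
  rw [Category.assoc, ι_scalarFamily, hr' _ x _ j (hXJ _)]
  have h1 := hz x x ((D x).π j ≫ (D x).ι j)
  have h2 : ((D x).π j ≫ (D x).ι j) ≫ z x =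
      (D x).π j ≫ ((D x).ι j ≫ z x ≫ (D x).π j) ≫ (D x).ι j := by
    have h3 : (D x).ι j = (D x).ι j ≫ (D x).π j ≫ (D x).ι j := by
      rw [reassoc_of% (D x).ι_π_self]
    conv_lhs => rw [h3]
    simp only [Category.assoc] at h1 ⊢
    rw [h1]
  rw [h2, hr]
  simp

/-- The functions on the simple classes are the centre of a detecting family of objects. -/
def scalarFamilyEquiv (hP : Detects P) : (SimpleClasses C → k) ≃ₗ[k] familyCenter k P :=
  LinearEquiv.ofBijective ((scalarFamily k D).codRestrict _ (scalarFamily_mem k D))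
    ⟨fun _ _ h => scalarFamily_injective k D (hP.exists_simpleClass_eq D)
      (congrArg Subtype.val h),
    fun z => by
      obtain ⟨c, hc⟩ := exists_scalarFamily_eq k D (hP.exists_simpleClass_eq D) z.1 z.2
      exact ⟨c, Subtype.ext hc⟩⟩

omit [IsAlgClosed k] [∀ X Y : C, Module.Finite k (X ⟶ Y)] in
include D in
theorem Detects.finite_simpleClasses [Finite X] (hP : Detects P) : Finite (SimpleClasses C) :=
  Finite.of_surjective (fun p : Σ x, (D x).J => simpleClass _ ((D p.1).simple p.2))
    fun c => by
      obtain ⟨x, j, h⟩ := hP.exists_simpleClass_eq D c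
      exact ⟨⟨x, j⟩, h⟩

include D in
theorem Detects.dim_eq_finrank [Finite X] (hP : Detects P) :
    Dim C = Module.finrank k (familyCenter k P) := by
  have := hP.finite_simpleClasses D
  have := Fintype.ofFinite (SimpleClasses C)
  rw [← (scalarFamilyEquiv k D hP).finrank_eq, Module.finrank_pi, Dim, Nat.card_eq_fintype_card]

end Center

/-! ### The centre of a linearized action groupoid -/

section ActionBasis

/-- The loops of an action: pairs of a point and an element that fixes it. -/
abbrev Loop (G X : Type) [Group G] [MulAction G X] : Type := {p : X × G // p.2 • p.1 = p.1}

/-- Conjugacy of loops. -/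
def Loop.Conj {G X : Type} [Group G] [MulAction G X] (p q : Loop G X) : Prop :=
  ∃ h : G, h • p.1.1 = q.1.1 ∧ h * p.1.2 * h⁻¹ = q.1.2

variable {C : Type u} [Category.{v} C] [Preadditive C]
variable (k : Type w) [Field k] [Linear k C]
variable (G : Type) [Group G] {X : Type} [MulAction G X]

/-- An identification of the morphisms between the objects `P x` with the linearization of the
action groupoid. -/
structure ActionBasis (P : X → C) where
  /-- the basis of the space of morphisms -/
  b : ∀ x y, Module.Basis {g : G // g • y = x} k (P x ⟶ P y)
  b_one : ∀ x, b x x ⟨1, one_smul _ _⟩ = 𝟙 (P x)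
  b_comp : ∀ x y z (g h : G) (hg : g • y = x) (hh : h • z = y),
    b x y ⟨g, hg⟩ ≫ b y z ⟨h, hh⟩ = b x z ⟨g * h, by rw [mul_smul, hh, hg]⟩

variable {k G} {P : X → C} (B : ActionBasis k G P)

namespace ActionBasis

/-- Conjugation between stabilizers. -/
def stabEquiv {x y : X} (h : G) (hh : h • y = x) : {g : G // g • y = y} ≃ {g : G // g • x = x} where
  toFun g := ⟨h * g.1 * h⁻¹, by rw [← hh]; simp [mul_smul, g.2]⟩
  invFun g := ⟨h⁻¹ * g.1 * h, by rw [mul_smul, mul_smul, hh, g.2, ← hh, inv_smul_smul]⟩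
  left_inv g := Subtype.ext (by simp [mul_assoc])
  right_inv g := Subtype.ext (by simp [mul_assoc])

theorem b_conj {x y : X} (h : G) (hh : h • y = x) (g : {g : G // g • y = y}) :
    B.b x y ⟨h, hh⟩ ≫ B.b y y g = B.b x x (stabEquiv h hh g) ≫ B.b x y ⟨h, hh⟩ := by
  obtain ⟨g, hg⟩ := g
  rw [B.b_comp, stabEquiv, Equiv.coe_fn_mk, B.b_comp]
  congr 2
  simp

variable [Finite G]

/-- The family of endomorphisms defined by a function on conjugacy classes of loops. -/
def loopFamily : (Quot (Loop.Conj (G := G) (X := X)) → k) →ₗ[k] ∀ x, P x ⟶ P x where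
  toFun c x :=
    have := Fintype.ofFinite {g : G // g • x = x}
    ∑ g : {g : G // g • x = x}, c (Quot.mk _ ⟨(x, g.1), g.2⟩) • B.b x x g
  map_add' c c' := by
    ext x
    simp [add_smul, Finset.sum_add_distrib]
  map_smul' r c := by
    ext x
    simp [mul_smul, Finset.smul_sum]

theorem loopFamily_apply (c : Quot (Loop.Conj (G := G) (X := X)) → k) (x : X)
    [Fintype {g : G // g • x = x}] : B.loopFamily c x =
      ∑ g : {g : G // g • x = x}, c (Quot.mk _ ⟨(x, g.1), g.2⟩) • B.b x x g := by
  simp only [loopFamily, LinearMap.coe_mk, AddHom.coe_mk]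
  congr!

theorem repr_loopFamily (c : Quot (Loop.Conj (G := G) (X := X)) → k) (x : X)
    (g : {g : G // g • x = x}) :
    (B.b x x).repr (B.loopFamily c x) g = c (Quot.mk _ ⟨(x, g.1), g.2⟩) := by
  have := Fintype.ofFinite {g : G // g • x = x}
  rw [loopFamily_apply, (B.b x x).repr_sum_self]

/-- It suffices to test on basis morphisms `h`. Conjugation by `h` matches the stabilizer of `y`
with that of `x`, and the coefficients agree because the matched loops are conjugate. -/
theorem loopFamily_mem (c : Quot (Loop.Conj (G := G) (X := X)) → k) :
    B.loopFamily c ∈ familyCenter k P := by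
  intro x y f
  have := Fintype.ofFinite {g : G // g • y = x}
  have := Fintype.ofFinite {g : G // g • y = y}
  have := Fintype.ofFinite {g : G // g • x = x}
  rw [← (B.b x y).sum_repr f, Preadditive.sum_comp, Preadditive.comp_sum]
  refine Finset.sum_congr rfl fun h _ => ?_
  rw [Linear.smul_comp, Linear.comp_smul, loopFamily_apply, loopFamily_apply, Preadditive.comp_sum,
    Preadditive.sum_comp]
  congr 1
  refine Fintype.sum_equiv (stabEquiv h.1 h.2) _ _ fun g => ?_
  rw [Linear.smul_comp, Linear.comp_smul, B.b_conj]
  congr 2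
  exact Quot.sound ⟨h.1, h.2, rfl⟩

theorem loopFamily_injective : Function.Injective B.loopFamily := by
  intro c c' h
  ext q
  obtain ⟨⟨⟨x, g⟩, hg⟩, rfl⟩ := Quot.exists_rep q
  have := B.repr_loopFamily c x ⟨g, hg⟩
  rw [h, repr_loopFamily] at this
  exact this.symm

theorem exists_loopFamily_eq (z : ∀ x, P x ⟶ P x) (hz : z ∈ familyCenter k P) :
    ∃ c, B.loopFamily c = z := by
  refine ⟨Quot.lift (fun p => (B.b p.1.1 p.1.1).repr (z p.1.1) ⟨p.1.2, p.2⟩) ?_, ?_⟩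
  · rintro ⟨⟨y, g⟩, hg⟩ ⟨⟨x, g'⟩, hg'⟩ ⟨h, hh, hgg⟩
    dsimp only at hh hgg hg hg' ⊢
    have := Fintype.ofFinite {g : G // g • y = y}
    -- Basis morphisms are invertible, so centrality determines `z x` as a conjugate of `z y`;
    -- comparing coordinates shows that they are constant on classes of loops.
    have h1 : z x = B.b x y ⟨h, hh⟩ ≫ z y ≫ B.b y x ⟨h⁻¹, by rw [← hh, inv_smul_smul]⟩ := by
      rw [← Category.assoc, hz x y, Category.assoc, B.b_comp]
      have : B.b x x ⟨h * h⁻¹, by simp⟩ = 𝟙 (P x) := by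
        rw [← B.b_one]; congr 2; simp
      rw [this, Category.comp_id]
    have h2 : z x = ∑ a, (B.b y y).repr (z y) a • B.b x x (stabEquiv h hh a) := by
      rw [h1]
      conv_lhs => rw [← (B.b y y).sum_repr (z y)]
      simp only [Preadditive.sum_comp, Preadditive.comp_sum, Linear.smul_comp, Linear.comp_smul]
      refine Finset.sum_congr rfl fun a _ => ?_
      obtain ⟨a, ha⟩ := a
      rw [B.b_comp, B.b_comp]
      congr 3
      simp [mul_assoc]
    have h3 : (⟨g', hg'⟩ : {g : G // g • x = x}) = stabEquiv h hh ⟨g, hg⟩ :=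
      Subtype.ext hgg.symm
    rw [h3, h2]
    classical
    simp [Finsupp.single_apply]
  · ext x
    have := Fintype.ofFinite {g : G // g • x = x}
    rw [loopFamily_apply]
    exact (B.b x x).sum_repr (z x)

/-- The centre has a basis indexed by conjugacy classes of loops. -/
def loopFamilyEquiv : (Quot (Loop.Conj (G := G) (X := X)) → k) ≃ₗ[k] familyCenter k P :=
  LinearEquiv.ofBijective (B.loopFamily.codRestrict _ B.loopFamily_mem)
    ⟨fun _ _ h => B.loopFamily_injective (congrArg Subtype.val h),
    fun z => by
      obtain ⟨c, hc⟩ := B.exists_loopFamily_eq z.1 z.2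
      exact ⟨c, Subtype.ext hc⟩⟩

include B in
theorem dim_eq [HasKernels C] [IsAlgClosed k] [∀ X Y : C, Module.Finite k (X ⟶ Y)] [Finite X]
    (D : ∀ x, SimpleDecomposition (P x)) (hP : Detects P) :
    Dim C = Nat.card (Quot (Loop.Conj (G := G) (X := X))) := by
  have := Fintype.ofFinite (Quot (Loop.Conj (G := G) (X := X)))
  rw [hP.dim_eq_finrank k D, ← B.loopFamilyEquiv.finrank_eq, Module.finrank_pi,
    Nat.card_eq_fintype_card]

end ActionBasis

end ActionBasis

/-! ### Linear algebra over a family of orthogonal objects with scalar endomorphisms -/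

section SchurFamily

variable (k : Type w) [Field k] {C : Type u} [Category.{v} C] [Preadditive C] [Linear k C]
variable {I : Type}

/-- A family of pairwise orthogonal objects with endomorphisms `k` through which all identities
factor. -/
structure IsSchurFamily (S : I → C) : Prop where
  hom_eq_zero : ∀ {i j}, i ≠ j → ∀ f : S i ⟶ S j, f = 0
  hom_self : ∀ i (f : S i ⟶ S i), ∃ c : k, f = c • 𝟙 (S i)
  id_ne_zero : ∀ i, 𝟙 (S i) ≠ 0
  resolution : ∀ X : C, ∃ (J : Type) (_ : Fintype J) (x : J → I) (p : ∀ j, X ⟶ S (x j))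
    (q : ∀ j, S (x j) ⟶ X), ∑ j, p j ≫ q j = 𝟙 X

namespace IsSchurFamily

variable {k} {S : I → C} (hS : IsSchurFamily k S)

include hS

theorem hom_ext {X Y : C} {f g : X ⟶ Y} (h : ∀ i (a : S i ⟶ X), a ≫ f = a ≫ g) : f = g := by
  obtain ⟨J, _, x, p, q, hpq⟩ := hS.resolution X
  rw [← Category.id_comp f, ← Category.id_comp g, ← hpq, Preadditive.sum_comp, Preadditive.sum_comp]
  exact Finset.sum_congr rfl fun j _ => by rw [Category.assoc, h, Category.assoc]

theorem exists_ne_zero {X : C} (hX : 𝟙 X ≠ 0) : ∃ i, ∃ a : S i ⟶ X, a ≠ 0 := by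
  by_contra! H
  exact hX (hS.hom_ext fun i a => by simp [H i a])

theorem finite_hom_family (i j : I) : Module.Finite k (S i ⟶ S j) := by
  by_cases h : i = j
  · subst h
    refine Module.Finite.of_surjective (LinearMap.toSpanSingleton k _ (𝟙 (S i))) fun f => ?_
    obtain ⟨c, hc⟩ := hS.hom_self i f
    exact ⟨c, hc.symm⟩
  · have : Subsingleton (S i ⟶ S j) :=
      ⟨fun f g => by rw [hS.hom_eq_zero h f, hS.hom_eq_zero h g]⟩
    infer_instance

theorem finite_hom (X Y : C) : Module.Finite k (X ⟶ Y) := by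
  obtain ⟨J, _, x, p, q, hpq⟩ := hS.resolution X
  obtain ⟨J', _, x', p', q', hpq'⟩ := hS.resolution Y
  have hfin (i j) := hS.finite_hom_family i j
  let L : (∀ (j : J) (j' : J'), (S (x j) ⟶ S (x' j'))) →ₗ[k] (X ⟶ Y) :=
    { toFun := fun a => ∑ j, ∑ j', p j ≫ a j j' ≫ q' j'
      map_add' := by intro a b; simp [Finset.sum_add_distrib]
      map_smul' := by intro r b; simp [Finset.smul_sum] }
  refine Module.Finite.of_surjective L fun f => ⟨fun j j' => q j ≫ f ≫ p' j', ?_⟩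
  have : f = (∑ j, p j ≫ q j) ≫ f ≫ ∑ j, p' j ≫ q' j := by rw [hpq, hpq']; simp
  conv_rhs => rw [this]
  simp only [L, Preadditive.sum_comp, Preadditive.comp_sum, LinearMap.coe_mk, AddHom.coe_mk,
    Category.assoc]
  exact Finset.sum_comm

/-- A morphism is the same as a family of linear maps on the multiplicity spaces `S i ⟶ X`. No
further naturality is needed, since the only morphisms within the family are scalars; the morphism
is read off from the values of `θ` on a resolution of `X`. -/
theorem exists_hom {X Y : C} (θ : ∀ i, (S i ⟶ X) →ₗ[k] (S i ⟶ Y)) :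
    ∃ f : X ⟶ Y, ∀ i a, a ≫ f = θ i a := by
  obtain ⟨J, _, x, p, q, hpq⟩ := hS.resolution X
  refine ⟨∑ j, p j ≫ θ _ (q j), fun i a => ?_⟩
  have h (j : J) : a ≫ p j ≫ θ _ (q j) = θ i (a ≫ p j ≫ q j) := by
    by_cases hi : i = x j
    · obtain ⟨c, hc⟩ : ∃ c : k, ∀ (Z : C) (t : S (x j) ⟶ Z), a ≫ p j ≫ t = c • (eqToHom (by rw [hi]) ≫ t) := by
        subst hi
        obtain ⟨c, hc⟩ := hS.hom_self _ (a ≫ p j)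
        exact ⟨c, fun Z t => by rw [← Category.assoc, hc]; simp⟩
      rw [hc, hc, map_smul]
      congr 1
      subst hi
      simp
    · have := hS.hom_eq_zero hi (a ≫ p j)
      rw [← Category.assoc, this, ← Category.assoc a, this, zero_comp, zero_comp, map_zero]
  rw [Preadditive.comp_sum, Finset.sum_congr rfl fun j _ => h j, ← map_sum, ← Preadditive.comp_sum,
    hpq, Category.comp_id]

/-- Every linear map has a quasi-inverse: project onto the range, then apply a section. These
quasi-inverses on multiplicity spaces assemble to a morphism by `exists_hom`. -/
theorem isRegular : IsRegular C := by
  intro X Y f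
  have h (i : I) : ∃ g : (S i ⟶ Y) →ₗ[k] (S i ⟶ X),
      ∀ a : S i ⟶ X, g (a ≫ f) ≫ f = a ≫ f := by
    let F : (S i ⟶ X) →ₗ[k] (S i ⟶ Y) := Linear.rightComp k (S i) f
    obtain ⟨s, hs⟩ := F.rangeRestrict.exists_rightInverse_of_surjective F.range_rangeRestrict
    obtain ⟨r, hr⟩ := (LinearMap.range F).subtype.exists_leftInverse_of_injective
      (Submodule.ker_subtype _)
    refine ⟨s ∘ₗ r, fun a => ?_⟩
    have h1 : r (a ≫ f) = F.rangeRestrict a := LinearMap.congr_fun hr (F.rangeRestrict a)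
    rw [LinearMap.comp_apply, h1]
    exact congrArg Subtype.val (LinearMap.congr_fun hs (F.rangeRestrict a))
  choose g hg using h
  obtain ⟨g', hg'⟩ := hS.exists_hom g
  refine ⟨g', hS.hom_ext fun i a => ?_⟩
  rw [← hg i a, ← hg', Category.assoc, Category.assoc]

/-- The image of `e` is the sum of one copy of `S i` for each basis vector of the range of `e` on `S
i ⟶ X`. The basis vectors themselves are the inclusions. -/
theorem isIdempotentComplete [Finite I] [HasFiniteBiproducts C] : IsIdempotentComplete C where
  idempotents_split X e he := by
    classical
    have := Fintype.ofFinite I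
    have hfin (i) := hS.finite_hom (S i) X
    let E (i : I) : (S i ⟶ X) →ₗ[k] (S i ⟶ X) := Linear.rightComp k (S i) e
    let b (i : I) := Module.finBasis k (LinearMap.range (E i))
    have hb (i l) : (b i l).1 ≫ e = (b i l).1 := by
      obtain ⟨a, ha⟩ := (b i l).2
      rw [← ha]
      simp [E, he]
    let N (t : Σ i, Fin (Module.finrank k (LinearMap.range (E i)))) : C := S t.1
    -- The projections are the coordinate functions of `a ≫ e`, turned into morphisms by
    -- `exists_hom`.
    have hp (t : Σ i, Fin (Module.finrank k (LinearMap.range (E i)))) :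
        ∃ p : X ⟶ S t.1, (∀ i, i ≠ t.1 → ∀ a : S i ⟶ X, a ≫ p = 0) ∧
          ∀ a : S t.1 ⟶ X, a ≫ p = (b t.1).repr ((E t.1).rangeRestrict a) t.2 • 𝟙 _ := by
      obtain ⟨p, hp⟩ := hS.exists_hom (X := X) (Y := S t.1) (fun i =>
        if h : i = t.1 then
          { toFun := fun a => (b i).repr ((E i).rangeRestrict a) (h ▸ t.2) • eqToHom (by rw [h])
            map_add' := by intro a a'; simp [add_smul]
            map_smul' := by intro r a; simp [mul_smul] } else 0)
      refine ⟨p, fun i hi a => by rw [hp, dif_neg hi]; rfl, fun a => ?_⟩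
      rw [hp, dif_pos rfl]
      simp
    choose p hp0 hp1 using hp
    refine ⟨⨁ N, biproduct.desc fun t => (b t.1 t.2).1, biproduct.lift p, ?_, ?_⟩
    · ext t t'
      simp only [biproduct.ι_desc_assoc, Category.assoc, biproduct.lift_π, Category.id_comp]
      obtain ⟨i, l⟩ := t'
      obtain ⟨i', l'⟩ := t
      by_cases hii : i = i'
      · subst hii
        refine (hp1 ⟨i, l'⟩ _).trans ?_
        have h1 : (E i).rangeRestrict (b i l).1 = b i l := Subtype.ext (hb i l)
        rw [h1, Module.Basis.repr_self, Finsupp.single_apply]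
        split_ifs with hl
        · subst hl
          simp only [one_smul, biproduct.ι_π_self]
          rfl
        · rw [biproduct.ι_π_ne _ (by simpa using hl), zero_smul]
      · rw [hp0 _ _ hii, biproduct.ι_π_ne _ (by simp [hii])]
    · refine hS.hom_ext fun i a => ?_
      rw [biproduct.lift_desc (f := N), Preadditive.comp_sum, Fintype.sum_sigma,
        Finset.sum_eq_single i]
      · have h1 := congrArg Subtype.val ((b i).sum_repr ((E i).rangeRestrict a))
        rw [AddSubmonoidClass.coe_finsetSum] at h1
        refine Eq.trans (Finset.sum_congr rfl fun l _ => ?_) h1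
        rw [← Category.assoc, hp1 ⟨i, l⟩]
        simp
      · intro i' _ hi
        refine Finset.sum_eq_zero fun l _ => ?_
        rw [← Category.assoc, hp0 _ _ hi.symm, zero_comp]
      · simp

end IsSchurFamily

end SchurFamily

/-! ### Orthogonal families in tensor powers and matrix categories -/

section TensorSchur

variable {k : Type w} [Field k] {C : Type u} [Category.{v} C] [Preadditive C] [Linear k C]

theorem exists_resolution_of_factors {I : Type} {S : I → C} {X : C} {J : Type} [Fintype J]
    {Y : J → C} (p : ∀ j, X ⟶ Y j) (q : ∀ j, Y j ⟶ X) (hpq : ∑ j, p j ≫ q j = 𝟙 X)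
    (hY : ∀ j, ∃ (J : Type) (_ : Fintype J) (x : J → I) (p : ∀ i, Y j ⟶ S (x i))
      (q : ∀ i, S (x i) ⟶ Y j), ∑ i, p i ≫ q i = 𝟙 (Y j)) :
    ∃ (J : Type) (_ : Fintype J) (x : J → I) (p : ∀ j, X ⟶ S (x j))
      (q : ∀ j, S (x j) ⟶ X), ∑ j, p j ≫ q j = 𝟙 X := by
  choose J' hJ' x p' q' h' using hY
  refine ⟨Σ j, J' j, inferInstance, fun t => x t.1 t.2, fun t => p t.1 ≫ p' t.1 t.2,
    fun t => q' t.1 t.2 ≫ q t.1, ?_⟩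
  rw [Fintype.sum_sigma, ← hpq]
  refine Finset.sum_congr rfl fun j _ => ?_
  calc _ = p j ≫ (∑ i, p' j i ≫ q' j i) ≫ q j := by
        simp [Preadditive.sum_comp, Preadditive.comp_sum]
    _ = p j ≫ q j := by rw [h', Category.id_comp]

theorem IsTwoVectorSpace.exists_isSchurFamily [IsAlgClosed k] [IsTwoVectorSpace k C] :
    ∃ S : Fin (Dim C) → C, IsSchurFamily k S := by
  have := IsTwoVectorSpace.finite_simples k (C := C)
  have := IsTwoVectorSpace.finite_hom (k := k) (C := C)
  have := IsTwoVectorSpace.toHasKernels k (C := C)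
  have := IsTwoVectorSpace.toHasFiniteBiproducts k (C := C)
  let e : SimpleClasses C ≃ Fin (Dim C) := Finite.equivFin _
  choose S hS hSe using fun i => exists_simpleClass_eq (e.symm i)
  refine ⟨S, ⟨fun {i j} hij f => ?_, fun i f => ?_, fun i => ?_, fun X => ?_⟩⟩
  · by_contra hf
    have := hS i
    have := hS j
    have := isIso_of_hom_simple hf
    refine hij (e.symm.injective ?_)
    rw [← hSe, ← hSe]
    exact (simpleClass_eq_iff _ _).2 ⟨asIso f⟩
  · have := hS i
    obtain ⟨c, hc⟩ := endomorphism_simple_eq_smul_id k f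
    exact ⟨c, hc.symm⟩
  · have := hS i
    exact id_nonzero _
  · obtain ⟨m, T, hT, ⟨φ⟩⟩ := IsTwoVectorSpace.semisimple (k := k) X
    have hT' (j : Fin m) : Nonempty (T j ≅ S (e (simpleClass (T j) (hT j)))) := by
      rw [← simpleClass_eq_iff (hT j) (hS _), hSe, e.symm_apply_apply]
    refine ⟨Fin m, inferInstance, fun j => e (simpleClass (T j) (hT j)),
      fun j => φ.hom ≫ biproduct.π T j ≫ (hT' j).some.hom,
      fun j => (hT' j).some.inv ≫ biproduct.ι T j ≫ φ.inv, ?_⟩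
    have h1 (j : Fin m) : (φ.hom ≫ biproduct.π T j ≫ (hT' j).some.hom) ≫
        (hT' j).some.inv ≫ biproduct.ι T j ≫ φ.inv =
        φ.hom ≫ (biproduct.π T j ≫ biproduct.ι T j) ≫ φ.inv := by simp
    simp only [h1, ← Preadditive.comp_sum, ← Preadditive.sum_comp, biproduct.total]
    simp

/-- A family of objects of `C` gives a family of formal tensor products, indexed by tuples. -/
def tupleFamily (k : Type w) {I ι : Type} (S : I → C) (x : ι → I) : TensorTuple k C ι :=
  ⟨fun i => S (x i)⟩

/-- A pure tensor of morphisms. -/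
def TensorTuple.pure {ι : Type} {X Y : TensorTuple k C ι} (f : ∀ i, X.obj i ⟶ Y.obj i) : X ⟶ Y :=
  PiTensorProduct.tprod k f

theorem TensorTuple.pure_comp {ι : Type} {X Y Z : TensorTuple k C ι}
    (f : ∀ i, X.obj i ⟶ Y.obj i) (g : ∀ i, Y.obj i ⟶ Z.obj i) :
    TensorTuple.pure f ≫ TensorTuple.pure g = TensorTuple.pure fun i => f i ≫ g i :=
  PiTensorProduct.map₂_tprod_tprod _ _ _

theorem TensorTuple.pure_eq_zero {ι : Type} {X Y : TensorTuple k C ι}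
    (f : ∀ i, X.obj i ⟶ Y.obj i) (i : ι) (h : f i = 0) : TensorTuple.pure f = 0 :=
  (PiTensorProduct.tprod k).map_coord_zero i h

theorem TensorTuple.pure_smul {ι : Type} [Fintype ι] {X Y : TensorTuple k C ι}
    (f : ∀ i, X.obj i ⟶ Y.obj i) (c : ι → k) :
    TensorTuple.pure (fun i => c i • f i) = (∏ i, c i) • TensorTuple.pure f :=
  (PiTensorProduct.tprod k).map_smul_univ c f

theorem TensorTuple.hom_induction {ι : Type} {X Y : TensorTuple k C ι} {p : (X ⟶ Y) → Prop}
    (h : ∀ (r : k) f, p (r • TensorTuple.pure f)) (hadd : ∀ f g, p f → p g → p (f + g))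
    (f : X ⟶ Y) : p f :=
  PiTensorProduct.induction_on (motive := p) f h hadd

/-- Everything reduces to pure tensors: a position where the colourings differ contributes a zero
factor, equal colourings give a product of scalars, and the tensor product of resolutions expands by
multilinearity. -/
theorem IsSchurFamily.tuple {I ι : Type} [Finite ι] {S : I → C} (hS : IsSchurFamily k S) :
    IsSchurFamily k (tupleFamily k (ι := ι) S) where
  hom_eq_zero {x y} hxy f := by
    obtain ⟨i, hi⟩ := Function.ne_iff.mp hxy
    induction f using TensorTuple.hom_induction with
    | h r f => rw [TensorTuple.pure_eq_zero f i (hS.hom_eq_zero hi _), smul_zero]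
    | hadd f g hf hg => rw [hf, hg, add_zero]
  hom_self x f := by
    have := Fintype.ofFinite ι
    induction f using TensorTuple.hom_induction with
    | h r f =>
      choose c hc using fun i => hS.hom_self (x i) (f i)
      refine ⟨r * ∏ i, c i, ?_⟩
      rw [mul_smul, funext hc]
      exact congrArg (r • ·) (TensorTuple.pure_smul _ c)
    | hadd f g hf hg =>
      obtain ⟨c, rfl⟩ := hf
      obtain ⟨c', rfl⟩ := hg
      exact ⟨c + c', (add_smul _ _ _).symm⟩
  id_ne_zero x h := by
    have := Fintype.ofFinite ι
    -- The identity tensor is nonzero because a tensor product of functionals, each with value 1 on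
    -- its identity, takes the value 1 on it.
    have hφ (i : ι) : ∃ φ : (S (x i) ⟶ S (x i)) →ₗ[k] k, φ (𝟙 _) = 1 := by
      obtain ⟨φ, hφ⟩ := (LinearMap.toSpanSingleton k _ (𝟙 (S (x i)))).exists_leftInverse_of_injective
        (LinearMap.ker_toSpanSingleton k (hS.id_ne_zero (x i)))
      exact ⟨φ, by simpa using LinearMap.congr_fun hφ 1⟩
    choose φ hφ using hφ
    let L : (⨂[k] i, (S (x i) ⟶ S (x i))) →ₗ[k] k :=
      PiTensorProduct.lift ((MultilinearMap.mkPiAlgebra k ι k).compLinearMap φ)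
    have h1 : L (PiTensorProduct.tprod k fun i => 𝟙 (S (x i))) = 1 := by simp [L, hφ]
    have h2 : (PiTensorProduct.tprod k fun i => 𝟙 (S (x i))) = 0 := h
    rw [h2, map_zero] at h1
    exact zero_ne_one h1
  resolution X := by
    classical
    have := Fintype.ofFinite ι
    choose J hJ x p q hpq using fun i => hS.resolution (X.obj i)
    refine ⟨∀ i, J i, inferInstance, fun t i => x i (t i),
      fun t => TensorTuple.pure fun i => p i (t i),
      fun t => TensorTuple.pure fun i => q i (t i), ?_⟩
    refine (Finset.sum_congr rfl fun t _ => TensorTuple.pure_comp _ _).trans ?_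
    exact ((PiTensorProduct.tprod k).map_sum fun i j => p i j ≫ q i j).symm.trans
      (congrArg (PiTensorProduct.tprod k) (funext hpq))

instance : (Mat_.embedding C).Linear k where
  map_smul _ _ := rfl

/-- The conditions on morphisms within the family transfer by full faithfulness; only the
resolutions require information on the objects of `D`. -/
theorem IsSchurFamily.of_fullyFaithful {D : Type*} [Category* D] [Preadditive D] [Linear k D]
    (F : C ⥤ D) [F.Additive] [F.Linear k] [F.Full] [F.Faithful] {I : Type} {S : I → C}
    (hS : IsSchurFamily k S)
    (hD : ∀ X : D, ∃ (J : Type) (_ : Fintype J) (Y : J → C) (p : ∀ j, X ⟶ F.obj (Y j))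
      (q : ∀ j, F.obj (Y j) ⟶ X), ∑ j, p j ≫ q j = 𝟙 X) :
    IsSchurFamily k (fun i => F.obj (S i)) where
  hom_eq_zero hij f := by
    obtain ⟨f, rfl⟩ := F.map_surjective f
    rw [hS.hom_eq_zero hij f, F.map_zero]
  hom_self i f := by
    obtain ⟨f, rfl⟩ := F.map_surjective f
    obtain ⟨c, rfl⟩ := hS.hom_self i f
    exact ⟨c, by rw [F.map_smul, F.map_id]⟩
  id_ne_zero i h := hS.id_ne_zero i (F.map_injective (by rw [F.map_id, h, F.map_zero]))
  resolution X := by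
    obtain ⟨J, _, Y, p, q, hpq⟩ := hD X
    refine exists_resolution_of_factors (S := fun i => F.obj (S i)) p q hpq fun j => ?_
    obtain ⟨J', _, x, p', q', hpq'⟩ := hS.resolution (Y j)
    exact ⟨J', inferInstance, x, fun i => F.map (p' i), fun i => F.map (q' i), by
      rw [← F.map_id, ← hpq', F.map_sum]; simp⟩

theorem IsSchurFamily.mat {I : Type} {S : I → C} (hS : IsSchurFamily k S) :
    IsSchurFamily k (fun i => (Mat_.embedding C).obj (S i)) :=
  hS.of_fullyFaithful (Mat_.embedding C) fun M => by
    let Y (i : M.ι) : Mat_ C := (Mat_.embedding C).obj (M.X i)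
    let e : M ≅ ⨁ Y := Mat_.isoBiproductEmbedding M
    refine ⟨M.ι, inferInstance, M.X, fun j => e.hom ≫ biproduct.π Y j,
      fun j => biproduct.ι Y j ≫ e.inv, ?_⟩
    have h1 (j : M.ι) : (e.hom ≫ biproduct.π Y j) ≫ biproduct.ι Y j ≫ e.inv =
        e.hom ≫ (biproduct.π Y j ≫ biproduct.ι Y j) ≫ e.inv := by
      simp only [Category.assoc]
    refine (Finset.sum_congr rfl fun j _ => h1 j).trans ?_
    rw [← Preadditive.comp_sum, ← Preadditive.sum_comp, biproduct.total]
    simp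

end TensorSchur

/-! ### Equivariant objects: averaging, retracts and direct sums -/

namespace Equivariant

variable {k : Type w} [Field k] {G : Type} [Group G]
variable {C : Type u} [Category.{v} C] [Preadditive C] [Linear k C] {R : TwoRep k G C}

/-- The action of the group on the morphisms between the underlying objects. -/
def conj (A B : Equivariant R) (g : G) : (A.V ⟶ B.V) →ₗ[k] (A.V ⟶ B.V) where
  toFun f := (A.ε g).hom ≫ (R.ρ g).map f ≫ (B.ε g).inv
  map_add' f f' := by
    have := R.additive g
    simp
  map_smul' r f := by
    have := R.linear g
    simp

theorem conj_apply (A B : Equivariant R) (g : G) (f : A.V ⟶ B.V) :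
    conj A B g f = (A.ε g).hom ≫ (R.ρ g).map f ≫ (B.ε g).inv := rfl

/-- Equivariant morphisms thereby become the invariants of a linear action on the morphisms of
underlying objects. -/
theorem mem_homs_iff {A B : Equivariant R} {f : A.V ⟶ B.V} :
    f ∈ A.homs B ↔ ∀ g, conj A B g f = f := by
  refine forall_congr' fun g => ?_
  rw [conj_apply, ← Category.assoc, Iso.comp_inv_eq]
  exact eq_comm

theorem conj_hom {A B : Equivariant R} (f : A ⟶ B) (g : G) : conj A B g f.1 = f.1 :=
  mem_homs_iff.1 f.2 g

theorem conj_comp {A B D : Equivariant R} (g : G) (f : A.V ⟶ B.V) (f' : B.V ⟶ D.V) :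
    conj A D g (f ≫ f') = conj A B g f ≫ conj B D g f' := by
  simp [conj_apply]

theorem conj_conj (A B : Equivariant R) (g h : G) (f : A.V ⟶ B.V) :
    conj A B g (conj A B h f) = conj A B (g * h) f := by
  rw [conj_apply A B (g * h), ← Category.assoc, Iso.eq_comp_inv, ← A.compat, ← B.compat]
  have := (R.φ g h).hom.naturality f
  simp only [conj_apply, Functor.map_comp, Category.assoc, Iso.inv_hom_id_assoc]
  simp only [Functor.comp_map] at this
  rw [← this, ← (R.ρ g).map_comp_assoc ((B.ε h).inv), Iso.inv_hom_id]
  simp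

/-- Compatibility of `ε 1` with `φ₁` is not part of the structure but follows: `conj A B 1` is
idempotent by `conj_conj`, and injective because `ρ 1` is isomorphic to the identity functor. -/
theorem conj_one (A B : Equivariant R) (f : A.V ⟶ B.V) : conj A B 1 f = f := by
  have h (f f' : A.V ⟶ B.V) (hf : conj A B 1 f = conj A B 1 f') :
      (R.ρ 1).map f = (R.ρ 1).map f' := by
    simpa [conj_apply] using hf
  have h1 := h _ _ ((conj_conj A B 1 1 f).trans (by rw [mul_one]))
  have h2 := R.φ₁.hom.naturality (conj A B 1 f)
  rw [h1, R.φ₁.hom.naturality] at h2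
  simpa using h2.symm

variable [Fintype G]

/-- The sum of the conjugates of a morphism. -/
def trace (A B : Equivariant R) (f : A.V ⟶ B.V) : A ⟶ B :=
  ⟨∑ g, conj A B g f, mem_homs_iff.2 fun h => by
    rw [map_sum]
    simp only [conj_conj]
    exact Fintype.sum_equiv (Equiv.mulLeft h) _ _ fun _ => rfl⟩

-- As `f` is invariant, every conjugate of a quasi-inverse of `f` is again a quasi-inverse. The
-- condition is affine, so the average satisfies it too, and the average is equivariant.
omit [Fintype G] in
theorem isRegular [Finite G] [CharZero k] (hC : IsRegular C) : IsRegular (Equivariant R) := by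
  intro A B f
  have := Fintype.ofFinite G
  obtain ⟨g, hg⟩ := hC f.1
  refine ⟨(Fintype.card G : k)⁻¹ • trace B A g, Subtype.ext ?_⟩
  change f.1 ≫ ((Fintype.card G : k)⁻¹ • ∑ σ, conj B A σ g) ≫ f.1 = f.1
  have h (σ : G) : f.1 ≫ conj B A σ g ≫ f.1 = f.1 := by
    conv_rhs => rw [← conj_hom f σ, ← hg]
    rw [conj_comp, conj_comp, conj_hom f]
  simp only [Linear.smul_comp, Linear.comp_smul, Preadditive.sum_comp, Preadditive.comp_sum, h]
  rw [Finset.sum_const, Finset.card_univ, ← Nat.cast_smul_eq_nsmul k, smul_smul,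
    inv_mul_cancel₀ (by simp), one_smul]

omit [Fintype G]

/-- A retract of the underlying object that is cut out by an equivariant idempotent is
equivariant. -/
def ofRetract (A : Equivariant R) (e : A ⟶ A) {Y : C} (i : Y ⟶ A.V) (p : A.V ⟶ Y)
    (hip : i ≫ p = 𝟙 Y) (hpi : p ≫ i = e.1) : Equivariant R where
  V := Y
  ε g :=
    { hom := i ≫ (A.ε g).hom ≫ (R.ρ g).map p
      inv := (R.ρ g).map i ≫ (A.ε g).inv ≫ p
      hom_inv_id := by
        have h := conj_hom e g
        rw [conj_apply, ← hpi] at h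
        simp only [Category.assoc, Functor.map_comp] at h ⊢
        rw [reassoc_of% h, reassoc_of% hip, hip]
      inv_hom_id := by
        have h := e.2 g
        rw [← hpi] at h
        simp only [Category.assoc] at h ⊢
        rw [reassoc_of% h]
        simp only [Functor.map_comp, Category.assoc, Iso.inv_hom_id_assoc]
        rw [← (R.ρ g).map_comp, ← (R.ρ g).map_comp, ← (R.ρ g).map_comp, hip, Category.comp_id, hip,
          CategoryTheory.Functor.map_id] }
  compat g h := by
    have he := e.2 g
    rw [← hpi] at he
    have hn := (R.φ g h).hom.naturality p
    simp only [Functor.comp_map] at hn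
    simp only [Category.assoc, Functor.map_comp] at he ⊢
    rw [hn, ← reassoc_of% he, reassoc_of% hip, ← A.compat]
    simp only [Category.assoc]

theorem isIdempotentComplete [IsIdempotentComplete C] : IsIdempotentComplete (Equivariant R) where
  idempotents_split A e he := by
    obtain ⟨Y, i, p, hip, hpi⟩ :=
      IsIdempotentComplete.idempotents_split A.V e.1 (congrArg Subtype.val he)
    refine ⟨ofRetract A e i p hip hpi, ⟨i, fun g => ?_⟩, ⟨p, fun g => ?_⟩, Subtype.ext hip,
      Subtype.ext hpi⟩
    · have h := e.2 g
      rw [← hpi] at h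
      simp only [Category.assoc] at h
      simp only [ofRetract, Category.assoc]
      rw [← Functor.map_comp, ← h, reassoc_of% hip]
    · have h := e.2 g
      rw [← hpi] at h
      simp only [Category.assoc] at h
      simp only [ofRetract]
      rw [reassoc_of% h, ← Functor.map_comp, Category.assoc, hip, Category.comp_id]

variable [HasFiniteBiproducts C]

/-- Direct sums of equivariant objects. -/
def directSum {n : ℕ} (A : Fin n → Equivariant R) : Equivariant R :=
  let Y (j : Fin n) : C := (A j).V
  -- Additivity of `ρ g` makes the images of the inclusions and projections a direct sum system, so
  -- the proposed inverse can be computed on each summand.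
  have h1 (g : G) (j : Fin n) : (R.ρ g).map (biproduct.ι Y j) ≫
      (∑ l, (R.ρ g).map (biproduct.π Y l) ≫ ((A l).ε g).inv ≫ biproduct.ι Y l) =
      ((A j).ε g).inv ≫ biproduct.ι Y j := by
    have := R.additive g
    rw [Preadditive.comp_sum, Finset.sum_eq_single j]
    · rw [← (R.ρ g).map_comp_assoc, biproduct.ι_π_self, CategoryTheory.Functor.map_id]
      exact Category.id_comp _
    · intro l _ hl
      rw [← (R.ρ g).map_comp_assoc, biproduct.ι_π_ne _ hl.symm, Functor.map_zero, zero_comp]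
    · simp
  { V := ⨁ Y
    ε := fun g =>
      { hom := biproduct.desc fun j => ((A j).ε g).hom ≫ (R.ρ g).map (biproduct.ι Y j)
        inv := ∑ j, (R.ρ g).map (biproduct.π Y j) ≫ ((A j).ε g).inv ≫ biproduct.ι Y j
        hom_inv_id := by
          refine biproduct.hom_ext' _ _ fun j => ?_
          rw [biproduct.ι_desc_assoc, Category.assoc, h1]
          simp
        inv_hom_id := by
          have := R.additive g
          simp only [Preadditive.sum_comp, Category.assoc, biproduct.ι_desc, Iso.inv_hom_id_assoc]
          simp only [← Functor.map_comp, ← Functor.map_sum]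
          rw [biproduct.total, CategoryTheory.Functor.map_id] }
    compat := fun g h => by
      refine biproduct.hom_ext' _ _ fun j => ?_
      have hn := (R.φ g h).hom.naturality (biproduct.ι Y j)
      simp only [Functor.comp_map] at hn
      rw [biproduct.ι_desc_assoc, Category.assoc, biproduct.ι_desc, ← (R.ρ g).map_comp_assoc,
        biproduct.ι_desc, ← (A j).compat]
      simp only [Category.assoc, Functor.map_comp, hn]
      rfl }

theorem directSum_π_mem {n : ℕ} (A : Fin n → Equivariant R) (j : Fin n) :
    biproduct.π (fun j => (A j).V) j ∈ (directSum A).homs (A j) := fun g => by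
  let Y (j : Fin n) : C := (A j).V
  have := R.additive g
  have h : biproduct.π Y j ≫ ((A j).ε g).hom =
      (biproduct.desc fun j => ((A j).ε g).hom ≫ (R.ρ g).map (biproduct.ι Y j)) ≫
        (R.ρ g).map (biproduct.π Y j) := by
    refine biproduct.hom_ext' _ _ fun l => ?_
    rw [biproduct.ι_desc_assoc, Category.assoc, ← Functor.map_comp]
    by_cases hl : l = j
    · subst hl
      rw [biproduct.ι_π_self, biproduct.ι_π_self_assoc, CategoryTheory.Functor.map_id]
      exact (Category.comp_id _).symm
    · rw [biproduct.ι_π_ne _ hl, biproduct.ι_π_ne_assoc _ hl, Functor.map_zero, zero_comp,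
        comp_zero]
  exact h

theorem directSum_ι_mem {n : ℕ} (A : Fin n → Equivariant R) (j : Fin n) :
    biproduct.ι (fun j => (A j).V) j ∈ (A j).homs (directSum A) := fun g =>
  biproduct.ι_desc (fun j => ((A j).ε g).hom ≫ (R.ρ g).map (biproduct.ι (fun j => (A j).V) j)) j

theorem hasFiniteBiproducts : HasFiniteBiproducts (Equivariant R) where
  out n :=
    { has_biproduct := fun A => by
        let b : Bicone A :=
          { pt := directSum A
            π := fun j => ⟨_, directSum_π_mem A j⟩
            ι := fun j => ⟨_, directSum_ι_mem A j⟩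
            ι_π := fun i j => by
              split_ifs with h
              · subst h
                exact Subtype.ext (biproduct.ι_π_self _ _)
              · exact Subtype.ext (biproduct.ι_π_ne _ h) }
        refine hasBiproduct_of_total b (Subtype.ext ?_)
        exact (map_sum (b.pt.homs b.pt).subtype (fun j => b.π j ≫ b.ι j) Finset.univ).trans
          biproduct.total }

omit [HasFiniteBiproducts C] in
theorem finite_hom [∀ X Y : C, Module.Finite k (X ⟶ Y)] (A B : Equivariant R) :
    Module.Finite k (A ⟶ B) :=
  inferInstanceAs (Module.Finite k (A.homs B))

end Equivariant

/-! ### Monomial matrices -/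

section Monomial

variable {D : Type u} [Category.{v} D] [Preadditive D]

open scoped Classical in
/-- The matrix with a single identity entry in each row. -/
def monomial {M N : Mat_ D} (e : M.ι → N.ι) (h : ∀ i, M.X i = N.X (e i)) : M ⟶ N :=
  fun i j => if p : e i = j then eqToHom ((h i).trans (congrArg N.X p)) else 0

theorem monomial_apply_self {M N : Mat_ D} (e : M.ι → N.ι) (h : ∀ i, M.X i = N.X (e i)) (i : M.ι) :
    monomial e h i (e i) = eqToHom (h i) := dif_pos rfl

theorem monomial_apply_of_ne {M N : Mat_ D} (e : M.ι → N.ι) (h : ∀ i, M.X i = N.X (e i)) {i : M.ι}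
    {j : N.ι} (hij : e i ≠ j) : monomial e h i j = 0 := dif_neg hij

theorem monomial_id (M : Mat_ D) : monomial (M := M) id (fun _ => rfl) = 𝟙 M := rfl

theorem monomial_comp_apply {M N K : Mat_ D} (e : M.ι → N.ι) (h : ∀ i, M.X i = N.X (e i))
    (f : N ⟶ K) (i : M.ι) (j : K.ι) :
    (monomial e h ≫ f) i j = eqToHom (h i) ≫ f (e i) j := by
  rw [Mat_.comp_apply, Finset.sum_eq_single (e i)]
  · rw [monomial_apply_self]
  · intro l _ hl
    rw [monomial_apply_of_ne e h hl.symm, zero_comp]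
  · simp

/-- Since the entries are transports along equalities, only the index maps matter. Coherence of
induced objects thus becomes a set of identities in the group. -/
theorem monomial_comp {M N K : Mat_ D} (e : M.ι → N.ι) (h : ∀ i, M.X i = N.X (e i))
    (e' : N.ι → K.ι) (h' : ∀ i, N.X i = K.X (e' i)) :
    monomial e h ≫ monomial e' h' = monomial (e' ∘ e) fun i => (h i).trans (h' (e i)) := by
  ext i j
  rw [monomial_comp_apply]
  by_cases hj : e' (e i) = j
  · subst hj
    rw [monomial_apply_self, eqToHom_trans]
    exact (monomial_apply_self (N := K) (e' ∘ e) _ i).symm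
  · rw [monomial_apply_of_ne _ _ hj, comp_zero]
    exact (monomial_apply_of_ne (N := K) (e' ∘ e) _ hj).symm

theorem monomial_congr {M N : Mat_ D} {e e' : M.ι → N.ι} (h : ∀ i, M.X i = N.X (e i))
    (h' : ∀ i, M.X i = N.X (e' i)) (he : ∀ i, e i = e' i) : monomial e h = monomial e' h' := by
  obtain rfl : e = e' := funext he
  rfl

theorem mapMat_map_monomial (F : D ⥤ D) [F.Additive] {M N : Mat_ D} (e : M.ι → N.ι)
    (h : ∀ i, M.X i = N.X (e i)) :
    F.mapMat_.map (monomial e h) =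
      monomial (M := F.mapMat_.obj M) (N := F.mapMat_.obj N) e fun i => congrArg F.obj (h i) := by
  refine Mat_.hom_ext _ _ fun (i : M.ι) (j : N.ι) => ?_
  by_cases hj : e i = j
  · subst hj
    exact (congrArg F.map (monomial_apply_self e h i)).trans ((eqToHom_map _ _).trans
      (monomial_apply_self (M := F.mapMat_.obj M) (N := F.mapMat_.obj N) e
        (fun i => congrArg F.obj (h i)) i).symm)
  · exact (congrArg F.map (monomial_apply_of_ne e h hj)).trans ((F.map_zero _ _).trans
      (monomial_apply_of_ne (M := F.mapMat_.obj M) (N := F.mapMat_.obj N) e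
        (fun i => congrArg F.obj (h i)) hj).symm)

end Monomial

/-! ### Induced equivariant objects and Frobenius reciprocity -/

section Induced

variable {k : Type w} [Field k] {C : Type u} [Category.{v} C] [Preadditive C] [Linear k C]
variable {n : ℕ}

theorem perm_obj_perm_obj (g a : Equiv.Perm (Fin n)) (Y : TensorTuple k C (Fin n)) :
    (TensorTuple.perm g).obj ((TensorTuple.perm a).obj Y) = (TensorTuple.perm (g * a)).obj Y := rfl

/-- The underlying object of the induced object. -/
abbrev inducedObj (Y : TensorTuple k C (Fin n)) : TensorPower k C n :=
  ⟨Equiv.Perm (Fin n), fun a => (TensorTuple.perm a).obj Y⟩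

theorem perm_obj_eq (Y : TensorTuple k C (Fin n)) (h a : Equiv.Perm (Fin n)) :
    (TensorTuple.perm a).obj Y = (TensorTuple.perm h).obj ((TensorTuple.perm (h⁻¹ * a)).obj Y) := by
  rw [perm_obj_perm_obj, mul_inv_cancel_left]

/-- The translates of the underlying object of the induced object. -/
abbrev inducedObjPerm (Y : TensorTuple k C (Fin n)) (h : Equiv.Perm (Fin n)) : TensorPower k C n :=
  ⟨Equiv.Perm (Fin n), fun a => (TensorTuple.perm h).obj ((TensorTuple.perm a).obj Y)⟩

theorem perm_perm_obj_eq (Y : TensorTuple k C (Fin n)) (g h a : Equiv.Perm (Fin n)) :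
    (TensorTuple.perm g).obj ((TensorTuple.perm a).obj Y) =
      (TensorTuple.perm (g * h)).obj ((TensorTuple.perm (h⁻¹ * a)).obj Y) :=
  congrArg (TensorTuple.perm g).obj (perm_obj_eq Y h a)

/-- The structure isomorphisms of the induced object. -/
def inducedIso (Y : TensorTuple k C (Fin n)) (h : Equiv.Perm (Fin n)) :
    inducedObj Y ≅ inducedObjPerm Y h where
  hom := monomial (fun a => h⁻¹ * a) (perm_obj_eq Y h)
  inv := monomial (fun a => h * a) fun a => perm_obj_perm_obj h a Y
  hom_inv_id := by
    rw [monomial_comp]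
    exact monomial_congr _ (fun _ => rfl) fun a => mul_inv_cancel_left h a
  inv_hom_id := by
    rw [monomial_comp]
    exact monomial_congr _ (fun _ => rfl) fun a => inv_mul_cancel_left h a

/-- The translates of the structure isomorphisms of the induced object. -/
def inducedIsoPerm (Y : TensorTuple k C (Fin n)) (g h : Equiv.Perm (Fin n)) :
    inducedObjPerm Y g ⟶ inducedObjPerm Y (g * h) :=
  (TensorTuple.perm g).mapMat_.map (inducedIso Y h).hom

theorem inducedIsoPerm_eq (Y : TensorTuple k C (Fin n)) (g h : Equiv.Perm (Fin n)) :
    inducedIsoPerm Y g h = monomial (M := inducedObjPerm Y g) (N := inducedObjPerm Y (g * h))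
      (fun a => h⁻¹ * a) (perm_perm_obj_eq Y g h) :=
  mapMat_map_monomial (TensorTuple.perm g) _ (perm_obj_eq Y h)

theorem inducedIso_compat (Y : TensorTuple k C (Fin n)) (g h : Equiv.Perm (Fin n)) :
    (inducedIso Y g).hom ≫ inducedIsoPerm Y g h = (inducedIso Y (g * h)).hom := by
  rw [inducedIsoPerm_eq, inducedIso, monomial_comp]
  refine monomial_congr _ (perm_obj_eq Y (g * h)) fun a => ?_
  change h⁻¹ * (g⁻¹ * a) = (g * h)⁻¹ * a
  rw [mul_inv_rev, mul_assoc]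

/-- The equivariant object induced from a formal tensor product. -/
@[reducible]
def induced (Y : TensorTuple k C (Fin n)) : SymPower k C n where
  V := inducedObj Y
  ε h := inducedIso Y h
  compat g h :=
    (congrArg ((inducedIso Y g).hom ≫ ·) (Category.comp_id
      ((TensorTuple.perm g).mapMat_.map (inducedIso Y h).hom))).trans (inducedIso_compat Y g h)

/-- The rows of a conjugate of a morphism out of an induced object. -/
theorem conj_induced_apply_eq_zero {Y : TensorTuple k C (Fin n)} {M : SymPower k C n}
    (f : inducedObj Y ⟶ M.V) (h a : Equiv.Perm (Fin n))
    (hf : ∀ j, f (h⁻¹ * a) j = 0) (j : M.V.ι) :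
    (Equivariant.conj (induced Y) M h f : inducedObj Y ⟶ M.V) a j = 0 := by
  let f' : (TensorTuple.perm h).mapMat_.obj (inducedObj Y) ⟶
    (TensorTuple.perm h).mapMat_.obj M.V := (TensorTuple.perm h).mapMat_.map f
  let t : (TensorTuple.perm h).mapMat_.obj M.V ⟶ M.V := (M.ε h).inv
  let f'' : inducedObjPerm Y h ⟶ M.V := f' ≫ t
  refine (monomial_comp_apply (M := inducedObj Y) (N := inducedObjPerm Y h) (fun a => h⁻¹ * a)
    (perm_obj_eq Y h) f'' a j).trans ?_
  have h0 : f'' (h⁻¹ * a) j = 0 := Finset.sum_eq_zero fun l _ =>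
    (congrArg (· ≫ t l j) ((congrArg (TensorTuple.perm h).map (hf l)).trans
      (Functor.map_zero _ _ _))).trans zero_comp
  exact (congrArg (eqToHom (perm_obj_eq Y h a) ≫ ·) h0).trans comp_zero

/-- The uniqueness half of Frobenius reciprocity: conjugation by `a` carries row `a⁻¹ * a = 1` to
row `a`, so an equivariant morphism is determined by its row at 1. -/
theorem induced_hom_eq_zero {Y : TensorTuple k C (Fin n)} {M : SymPower k C n}
    (f : induced Y ⟶ M) (hf : ∀ j, (f.1 : inducedObj Y ⟶ M.V) 1 j = 0) : f = 0 := by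
  refine Subtype.ext (Mat_.hom_ext _ _ fun (a : Equiv.Perm (Fin n)) j => ?_)
  have h1 := conj_induced_apply_eq_zero f.1 a a (by rwa [inv_mul_cancel]) j
  rwa [Equivariant.conj_hom f a] at h1

theorem Mat_sum_apply {D : Type*} [Category* D] [Preadditive D] {M N : Mat_ D} {J : Type*}
    (s : Finset J) (f : J → (M ⟶ N)) (i : M.ι) (j : N.ι) :
    (∑ l ∈ s, f l) i j = ∑ l ∈ s, f l i j := by
  classical
  induction s using Finset.induction_on with
  | empty => rfl
  | insert l s hl ih => rw [Finset.sum_insert hl, Finset.sum_insert hl, ← ih]; rfl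

/-- The existence half: put `f` in row 1, zero in the other rows, and sum over the group. Row 1 of
the conjugate by `g` comes from row `g⁻¹`, so only `g = 1` contributes to it. -/
theorem exists_induced_hom_ne_zero {Y : TensorTuple k C (Fin n)} {M : SymPower k C n}
    (f : (Mat_.embedding _).obj Y ⟶ M.V) (hf : f ≠ 0) : ∃ F : induced Y ⟶ M, F ≠ 0 := by
  classical
  let F₀ : inducedObj Y ⟶ M.V := fun a j => if h : a = (1 : Equiv.Perm (Fin n)) then
    eqToHom (show (TensorTuple.perm a).obj Y = (TensorTuple.perm 1).obj Y by rw [h]) ≫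
      (f PUnit.unit j : Y ⟶ M.V.X j) else 0
  refine ⟨Equivariant.trace (induced Y) M F₀, fun h => hf ?_⟩
  refine Mat_.hom_ext _ _ fun _ j => ?_
  have h1 : (∑ g, Equivariant.conj (induced Y) M g F₀ : inducedObj Y ⟶ M.V) 1 j = 0 :=
    congrArg (fun F : induced Y ⟶ M => (F.1 : inducedObj Y ⟶ M.V) 1 j) h
  rw [Mat_sum_apply, Finset.sum_eq_single 1, Equivariant.conj_one] at h1
  · have h3 : F₀ 1 j = f PUnit.unit j := (dif_pos rfl).trans (Category.id_comp _)
    exact h3.symm.trans h1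
  · intro g _ hg
    exact conj_induced_apply_eq_zero F₀ g 1
      (fun l => dif_neg fun h => hg (by simpa using h)) j
  · simp

end Induced

/-- Colourings of `Fin n` by `I`, with the action of the symmetric group by permutation. -/
def Coloring (n : ℕ) (I : Type) : Type := Fin n → I

instance (n : ℕ) (I : Type) : MulAction (Equiv.Perm (Fin n)) (Coloring n I) where
  smul g x := fun i => x (g.symm i)
  one_smul _ := rfl
  mul_smul _ _ _ := rfl

instance (n : ℕ) (I : Type) [Finite I] : Finite (Coloring n I) :=
  inferInstanceAs (Finite (Fin n → I))

theorem Coloring.smul_apply {n : ℕ} {I : Type} (g : Equiv.Perm (Fin n)) (x : Coloring n I)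
    (i : Fin n) : (g • x) i = x (g.symm i) := rfl

theorem eqToHom_ne_zero {D : Type*} [Category* D] [HasZeroMorphisms D] {X Y : D} (h : X = Y)
    (hX : 𝟙 X ≠ 0) : eqToHom h ≠ 0 := by
  subst h
  exact hX

/-! ### Morphisms between induced objects and semisimplicity of symmetric powers -/

section SymPower

variable {k : Type w} [Field k] {C : Type u} [Category.{v} C] [Preadditive C] [Linear k C]
variable {n : ℕ} {I : Type} (S : I → C)

theorem IsSchurFamily.exists_eq_smul_eqToHom {S : I → C} (hS : IsSchurFamily k S) {i j : I}
    (h : i = j) (f : S i ⟶ S j) : ∃ c : k, f = c • eqToHom (congrArg S h) := by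
  subst h
  exact hS.hom_self i f

variable (k) in
/-- The object induced from the formal tensor product of the simple objects given by a
colouring. -/
abbrev inducedFamily (x : Coloring n I) : SymPower k C n := induced (tupleFamily k S x)

theorem perm_tupleFamily {x y : Coloring n I} (g : Equiv.Perm (Fin n)) (hg : g • y = x)
    (a : Equiv.Perm (Fin n)) :
    (TensorTuple.perm a).obj (tupleFamily k S x) =
      (TensorTuple.perm (a * g)).obj (tupleFamily k S y) := by
  subst hg
  rfl

/-- The morphism between the underlying objects of induced objects defined by right
multiplication. -/
def inducedMulMap {x y : Coloring n I} (g : Equiv.Perm (Fin n)) (hg : g • y = x) :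
    inducedObj (tupleFamily k S x) ⟶ inducedObj (tupleFamily k S y) :=
  monomial (fun a => a * g) (perm_tupleFamily S g hg)

/-- The translates of `inducedMulMap`. -/
def inducedMulMapPerm {x y : Coloring n I} (g : Equiv.Perm (Fin n)) (hg : g • y = x)
    (h : Equiv.Perm (Fin n)) :
    inducedObjPerm (tupleFamily k S x) h ⟶ inducedObjPerm (tupleFamily k S y) h :=
  (TensorTuple.perm h).mapMat_.map (inducedMulMap S g hg)

theorem inducedMulMapPerm_eq {x y : Coloring n I} (g : Equiv.Perm (Fin n)) (hg : g • y = x)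
    (h : Equiv.Perm (Fin n)) : inducedMulMapPerm (k := k) S g hg h = monomial (fun a => a * g)
      fun a => congrArg (TensorTuple.perm h).obj (perm_tupleFamily S g hg a) :=
  mapMat_map_monomial (TensorTuple.perm h) _ (perm_tupleFamily S g hg)

/-- The equivariant structure is left multiplication on indices, and it commutes with right
multiplication. -/
theorem inducedMulMap_comm {x y : Coloring n I} (g : Equiv.Perm (Fin n)) (hg : g • y = x)
    (h : Equiv.Perm (Fin n)) :
    inducedMulMap S g hg ≫ (inducedIso (tupleFamily k S y) h).hom =
      (inducedIso (tupleFamily k S x) h).hom ≫ inducedMulMapPerm S g hg h := by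
  rw [inducedMulMapPerm_eq, inducedMulMap, inducedIso, inducedIso, monomial_comp, monomial_comp]
  exact monomial_congr _ _ fun a => (mul_assoc h⁻¹ a g).symm

/-- The morphism between induced objects defined by right multiplication. -/
def inducedMul {x y : Coloring n I} (g : Equiv.Perm (Fin n)) (hg : g • y = x) :
    inducedFamily k S x ⟶ inducedFamily k S y :=
  ⟨inducedMulMap S g hg, inducedMulMap_comm S g hg⟩

theorem inducedMul_one (x : Coloring n I) :
    inducedMul S 1 (one_smul _ x) = 𝟙 (inducedFamily k S x) :=
  Subtype.ext ((monomial_congr (perm_tupleFamily S 1 (one_smul _ x)) (fun _ => rfl)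
    fun a => mul_one a).trans (monomial_id _))

theorem inducedMul_comp {x y z : Coloring n I} (g h : Equiv.Perm (Fin n)) (hg : g • y = x)
    (hh : h • z = y) : inducedMul (k := k) S g hg ≫ inducedMul S h hh =
      inducedMul S (g * h) (by rw [mul_smul, hh, hg]) := by
  refine Subtype.ext ?_
  change inducedMulMap S g hg ≫ inducedMulMap S h hh = inducedMulMap S (g * h) (by rw [mul_smul, hh, hg])
  rw [inducedMulMap, inducedMulMap, monomial_comp]
  exact monomial_congr _ _ fun a => mul_assoc a g h

/-- The entries in the first row of a morphism out of an induced object. -/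
def inducedEntry (Y : TensorTuple k C (Fin n)) (M : SymPower k C n) (j : M.V.ι) :
    (induced Y ⟶ M) →ₗ[k] ((TensorTuple.perm 1).obj Y ⟶ M.V.X j) where
  toFun F := (F.1 : inducedObj Y ⟶ M.V) 1 j
  map_add' _ _ := rfl
  map_smul' _ _ := rfl

theorem inducedEntry_mul_self {x y : Coloring n I} (g : Equiv.Perm (Fin n)) (hg : g • y = x) :
    inducedEntry (tupleFamily k S x) (inducedFamily k S y) g (inducedMul S g hg) =
      eqToHom (perm_tupleFamily S g hg 1) :=
  dif_pos (one_mul g)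

theorem inducedEntry_mul_of_ne {x y : Coloring n I} (g : Equiv.Perm (Fin n)) (hg : g • y = x)
    (c : Equiv.Perm (Fin n)) (hc : g ≠ c) :
    inducedEntry (tupleFamily k S x) (inducedFamily k S y) c (inducedMul S g hg) = 0 :=
  dif_neg fun h => hc ((one_mul g).symm.trans h)

variable {S}

/-- In row 1, the morphism given by `g` has its only nonzero entry in column `g`, so the
coefficients can be read off from that row. -/
theorem linearIndependent_inducedMul (hS : IsSchurFamily k S) (x y : Coloring n I) :
    LinearIndependent k fun g : {g : Equiv.Perm (Fin n) // g • y = x} =>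
      inducedMul (k := k) S g.1 g.2 := by
  rw [linearIndependent_iff']
  intro s c hc g hg
  have h := congrArg (inducedEntry (tupleFamily k S x) (inducedFamily k S y) g.1) hc
  rw [map_sum, map_zero, Finset.sum_eq_single g, map_smul, inducedEntry_mul_self] at h
  · exact (smul_eq_zero.mp h).resolve_right
      (eqToHom_ne_zero _ (hS.tuple.id_ne_zero (x : Fin n → I)))
  · intro g' _ hg'
    rw [map_smul, inducedEntry_mul_of_ne _ _ _ _ (fun h => hg' (Subtype.ext h)), smul_zero]
  · exact fun h => (h hg).elim

/-- The entry of `F` at `(1, j)` is a morphism between the tensor products at `x` and `j • y`: zero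
if the colourings differ, a scalar otherwise. Row 1 determines `F`. -/
theorem span_inducedMul (hS : IsSchurFamily k S) (x y : Coloring n I) :
    ⊤ ≤ Submodule.span k (Set.range fun g : {g : Equiv.Perm (Fin n) // g • y = x} =>
      inducedMul (k := k) S g.1 g.2) := by
  intro F _
  have h (g : {g : Equiv.Perm (Fin n) // g • y = x}) : ∃ c : k,
      inducedEntry (tupleFamily k S x) (inducedFamily k S y) g.1 F =
        c • eqToHom (perm_tupleFamily S g.1 g.2 1) :=
    hS.tuple.exists_eq_smul_eqToHom (i := ((1 : Equiv.Perm (Fin n)) • x : Coloring n I))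
      (j := g.1 • y) (by rw [g.2, one_smul]) _
  choose c hc using h
  have := Fintype.ofFinite {g : Equiv.Perm (Fin n) // g • y = x}
  have hF : F - ∑ g, c g • inducedMul S g.1 g.2 = 0 := by
    refine induced_hom_eq_zero _ fun (j : Equiv.Perm (Fin n)) => ?_
    suffices inducedEntry (tupleFamily k S x) (inducedFamily k S y) j
      (F - ∑ g, c g • inducedMul S g.1 g.2) = 0 from this
    rw [map_sub, map_sum, sub_eq_zero]
    by_cases hj : j • y = x
    · rw [Finset.sum_eq_single ⟨j, hj⟩, map_smul, inducedEntry_mul_self S j hj]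
      · exact hc ⟨j, hj⟩
      · intro g _ hg
        rw [map_smul, inducedEntry_mul_of_ne _ _ _ _ (fun h => hg (Subtype.ext h)), smul_zero]
      · simp
    · rw [Finset.sum_eq_zero]
      · exact hS.tuple.hom_eq_zero (i := ((1 : Equiv.Perm (Fin n)) • x : Coloring n I))
          (j := j • y) (by rw [one_smul]; exact fun h => hj h.symm) _
      · intro g _
        rw [map_smul, inducedEntry_mul_of_ne _ _ _ _ (fun h : g.1 = j => hj (h ▸ g.2)), smul_zero]
  rw [sub_eq_zero.mp hF]
  exact Submodule.sum_mem _ fun g _ => Submodule.smul_mem _ _ (Submodule.subset_span ⟨g, rfl⟩)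

/-- The morphisms between the induced objects are the linearized action groupoid. -/
def inducedActionBasis (hS : IsSchurFamily k S) :
    ActionBasis k (Equiv.Perm (Fin n)) (inducedFamily (n := n) k S) where
  b x y := Module.Basis.mk (linearIndependent_inducedMul hS x y) (span_inducedMul hS x y)
  b_one x := by
    rw [Module.Basis.mk_apply]
    exact inducedMul_one S x
  b_comp x y z g h hg hh := by
    rw [Module.Basis.mk_apply, Module.Basis.mk_apply, Module.Basis.mk_apply]
    exact inducedMul_comp S g h hg hh

theorem detects_inducedFamily (hS : IsSchurFamily k S) : Detects (inducedFamily (n := n) k S) := by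
  intro M hM
  have h1 : 𝟙 M.V ≠ 0 := fun h => id_nonzero M (Subtype.ext h)
  obtain ⟨x, a, ha⟩ := hS.tuple.mat.exists_ne_zero h1
  obtain ⟨F, hF⟩ := exists_induced_hom_ne_zero a ha
  exact ⟨x, F, hF⟩

variable (n)

/-- Symmetric powers of semisimple categories are 2-vector spaces, and their simple objects are
counted by the conjugacy classes of loops in the groupoid of colourings. -/
theorem IsSchurFamily.symPower [Finite I] [IsAlgClosed k] [CharZero k] (hS : IsSchurFamily k S) :
    IsTwoVectorSpace k (SymPower k C n) ∧ Dim (SymPower k C n) =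
      Nat.card (Quot (Loop.Conj (G := Equiv.Perm (Fin n)) (X := Coloring n I))) := by
  have hD := (hS.tuple (ι := Fin n)).mat
  have hreg : IsRegular (SymPower k C n) := Equivariant.isRegular hD.isRegular
  have := hD.isIdempotentComplete
  have : IsIdempotentComplete (SymPower k C n) := Equivariant.isIdempotentComplete
  have := hD.finite_hom
  have hfin : ∀ X Y : SymPower k C n, Module.Finite k (X ⟶ Y) := Equivariant.finite_hom
  have := hreg.hasKernels
  have hbi : HasFiniteBiproducts (SymPower k C n) := Equivariant.hasFiniteBiproducts
  have hdec (X : SymPower k C n) : SimpleDecomposition X :=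
    (hreg.exists_simpleDecomposition k X).some
  have hdet := detects_inducedFamily (n := n) hS
  refine ⟨?_, (inducedActionBasis hS).dim_eq (fun x => hdec _) hdet⟩
  exact
    { toHasFiniteBiproducts := hbi
      toHasKernels := hreg.hasKernels
      toHasCokernels := hreg.hasCokernels
      toIsNormalMonoCategory := hreg.isNormalMonoCategory
      toIsNormalEpiCategory := hreg.isNormalEpiCategory
      semisimple := fun X => (hdec X).exists_iso
      finite_simples := hdet.finite_simpleClasses fun x => hdec _
      finite_hom := hfin }

end SymPower

/-! ### Loops of colourings and families of partitions -/

section Combinatorics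

open Equiv.Perm in
theorem cycleType_eq_of_intertwining {α β : Type*} [Fintype α] [DecidableEq α] [Fintype β]
    [DecidableEq β] {σ : Equiv.Perm α} {τ : Equiv.Perm β} (e : α ≃ β)
    (h : ∀ a, e (σ a) = τ (e a)) : σ.cycleType = τ.cycleType := by
  let f : α ≃ {b : β // True} := e.trans (Equiv.subtypeUnivEquiv fun _ => trivial).symm
  rw [← cycleType_extendDomain f (g := σ)]
  congr 1
  ext b
  have := extendDomain_apply_subtype σ f (b := b) trivial
  rw [this]
  have hb : f.symm ⟨b, trivial⟩ = e.symm b := rfl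
  rw [hb]
  change e (σ (e.symm b)) = τ b
  rw [h, e.apply_symm_apply]

/-- The cycle lengths of a permutation of a finite type, including fixed points, as a partition of
the number of elements. -/
def cyclePartition {α : Type} [Finite α] (σ : Equiv.Perm α) : Σ m, Nat.Partition m :=
  haveI := Fintype.ofFinite α
  haveI := Classical.decEq α
  ⟨_, σ.partition⟩

theorem cyclePartition_eq {α : Type} [Fintype α] [DecidableEq α] (σ : Equiv.Perm α) :
    cyclePartition σ = ⟨_, σ.partition⟩ := by
  unfold cyclePartition
  congr!

theorem sigma_partition_ext {p q : Σ m, Nat.Partition m} (h : p.2.parts = q.2.parts) : p = q := by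
  obtain ⟨m, p⟩ := p
  obtain ⟨m', q⟩ := q
  obtain rfl : m = m' := by rw [← p.parts_sum, ← q.parts_sum, h]
  congr 1
  exact Nat.Partition.ext h

/-- Equal partitions give sets of equal size and, keeping the parts that are at least 2, equal cycle
types. After transport to one set, the permutations are conjugate. -/
theorem cyclePartition_eq_iff {α β : Type} [Finite α] [Finite β] {σ : Equiv.Perm α}
    {τ : Equiv.Perm β} :
    cyclePartition σ = cyclePartition τ ↔ ∃ e : α ≃ β, ∀ a, e (σ a) = τ (e a) := by
  classical
  have := Fintype.ofFinite α
  have := Fintype.ofFinite β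
  rw [cyclePartition_eq, cyclePartition_eq]
  constructor
  · intro h
    have hc : Fintype.card α = Fintype.card β := congrArg Sigma.fst h
    let e₀ := Fintype.equivOfCardEq hc
    let τ' : Equiv.Perm α := (e₀.trans τ).trans e₀.symm
    have h1 : τ'.cycleType = τ.cycleType := cycleType_eq_of_intertwining e₀ fun a => by simp [τ']
    have h2 : σ.cycleType = τ.cycleType := by
      rw [← σ.filter_parts_partition_eq_cycleType, ← τ.filter_parts_partition_eq_cycleType]
      exact congrArg (fun p : Σ m, Nat.Partition m => p.2.parts.filter (2 ≤ ·)) h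
    obtain ⟨c, hc⟩ := isConj_iff.1 (Equiv.Perm.isConj_iff_cycleType_eq.2 (h2.trans h1.symm))
    refine ⟨c.trans e₀, fun a => ?_⟩
    have h3 := Equiv.congr_fun hc (c a)
    have h4 : c⁻¹ (c a) = a := c.symm_apply_apply a
    rw [Equiv.Perm.mul_apply, Equiv.Perm.mul_apply, h4] at h3
    rw [Equiv.trans_apply, h3]
    simp [τ']
  · rintro ⟨e, he⟩
    apply sigma_partition_ext
    have hc := cycleType_eq_of_intertwining e he
    dsimp only
    rw [Equiv.Perm.parts_partition, Equiv.Perm.parts_partition, ← Equiv.Perm.sum_cycleType,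
      ← Equiv.Perm.sum_cycleType, hc, Fintype.card_congr e]

/-- As `cycleType` omits fixed points, a partition must be recovered from its parts that are at
least 2 by padding with ones. -/
theorem Nat.Partition.parts_eq_filter_add {m : ℕ} (p : Nat.Partition m) :
    p.parts = p.parts.filter (2 ≤ ·) +
      Multiset.replicate (m - (p.parts.filter (2 ≤ ·)).sum) 1 := by
  have h1 : p.parts.filter (fun a => ¬ 2 ≤ a) =
      Multiset.replicate (p.parts.filter (fun a => ¬ 2 ≤ a)).card 1 :=
    Multiset.eq_replicate_card.2 fun a ha => by
      have := p.parts_pos (Multiset.mem_of_mem_filter ha)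
      have := Multiset.of_mem_filter ha
      omega
  have h2 := Multiset.filter_add_not (2 ≤ ·) p.parts
  have h3 := congrArg Multiset.sum h2
  rw [Multiset.sum_add, p.parts_sum, h1, Multiset.sum_replicate, smul_eq_mul, mul_one] at h3
  conv_lhs => rw [← h2, h1]
  congr 2
  omega

theorem exists_cyclePartition_eq (p : Σ m, Nat.Partition m) :
    ∃ σ : Equiv.Perm (Fin p.1), cyclePartition σ = p := by
  obtain ⟨m, p⟩ := p
  have hp := Nat.Partition.parts_eq_filter_add p
  have hs : (p.parts.filter (2 ≤ ·)).sum ≤ m := by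
    have h3 := congrArg Multiset.sum hp
    rw [Multiset.sum_add, p.parts_sum] at h3
    omega
  obtain ⟨σ, hσ⟩ := (Equiv.Perm.exists_with_cycleType_iff (Fin m)
    (m := p.parts.filter (2 ≤ ·))).2 ⟨by simpa using hs, fun a ha => Multiset.of_mem_filter ha⟩
  refine ⟨σ, ?_⟩
  rw [cyclePartition_eq]
  apply sigma_partition_ext
  dsimp only
  rw [Equiv.Perm.parts_partition, ← Equiv.Perm.sum_cycleType, hσ, Fintype.card_fin]
  exact hp.symm

variable {n : ℕ} {I : Type}

theorem Loop.apply_eq (l : Loop (Equiv.Perm (Fin n)) (Coloring n I)) (a : Fin n) :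
    l.1.1 (l.1.2 a) = l.1.1 a := by
  have h := congrFun (l.2 : (l.1.2 • l.1.1 : Fin n → I) = l.1.1) (l.1.2 a)
  rw [← h]
  exact congrArg l.1.1 (l.1.2.symm_apply_apply a)

/-- The restriction of the permutation to the elements of one colour. -/
def Loop.restrict (l : Loop (Equiv.Perm (Fin n)) (Coloring n I)) (i : I) :
    Equiv.Perm {a : Fin n // l.1.1 a = i} :=
  l.1.2.subtypePerm fun a => by rw [l.apply_eq]

/-- A conjugation of loops maps each colour class to the class of the same colour and intertwines
the restricted permutations. Conversely, intertwining bijections of the colour classes glue to one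
permutation of `Fin n`. -/
theorem Loop.conj_iff (l l' : Loop (Equiv.Perm (Fin n)) (Coloring n I)) :
    Loop.Conj l l' ↔ ∀ i, cyclePartition (l.restrict i) = cyclePartition (l'.restrict i) := by
  constructor
  · rintro ⟨h, h1, h2⟩ i
    rw [cyclePartition_eq_iff]
    have h3 (a : Fin n) : l.1.1 a = i ↔ l'.1.1 (h a) = i := by
      rw [← h1, Coloring.smul_apply, Equiv.symm_apply_apply]
    refine ⟨h.subtypeEquiv h3, fun a => Subtype.ext ?_⟩
    change h (l.1.2 a.1) = l'.1.2 (h a.1)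
    rw [← h2]
    simp
  · intro H
    choose e he using fun i => cyclePartition_eq_iff.1 (H i)
    let h : Equiv.Perm (Fin n) := (Equiv.sigmaFiberEquiv l.1.1).symm.trans
      ((Equiv.sigmaCongrRight e).trans (Equiv.sigmaFiberEquiv l'.1.1))
    have h1 (i : I) (a : {a : Fin n // l.1.1 a = i}) : h a.1 = (e i a).1 := by
      obtain ⟨a, rfl⟩ := a
      rfl
    refine ⟨h, ?_, ?_⟩
    · refine funext fun b => ?_
      obtain ⟨a, rfl⟩ := h.surjective b
      rw [Coloring.smul_apply, Equiv.symm_apply_apply, h1 _ ⟨a, rfl⟩]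
      exact (e _ ⟨a, rfl⟩).2.symm
    · rw [mul_inv_eq_iff_eq_mul]
      ext a
      rw [Equiv.Perm.mul_apply, Equiv.Perm.mul_apply, h1 _ ⟨a, rfl⟩, h1 _ ⟨_, l.apply_eq a⟩]
      exact congrArg (fun t => (t.1 : ℕ)) (he (l.1.1 a) ⟨a, rfl⟩)

variable [Fintype I]

/-- Families of partitions with total size `n`. -/
abbrev PartitionFamily (n : ℕ) (I : Type) [Fintype I] : Type :=
  {p : I → Σ m, Nat.Partition m // ∑ i, (p i).1 = n}

/-- The family of cycle partitions of a loop. -/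
def Loop.partitionFamily (l : Loop (Equiv.Perm (Fin n)) (Coloring n I)) : PartitionFamily n I :=
  ⟨fun i => cyclePartition (l.restrict i), by
    classical
    have h (i : I) : (cyclePartition (l.restrict i)).1 = Fintype.card {a : Fin n // l.1.1 a = i} := by
      rw [cyclePartition_eq]
    rw [Finset.sum_congr rfl fun i _ => h i, ← Fintype.card_sigma,
      Fintype.card_congr (Equiv.sigmaFiberEquiv l.1.1), Fintype.card_fin]⟩

/-- Take the disjoint union of permutations realizing the given partitions, coloured by the index of
the component. -/
theorem Loop.partitionFamily_surjective :
    Function.Surjective (Loop.partitionFamily (n := n) (I := I)) := by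
  rintro ⟨p, hp⟩
  choose σ hσ using fun i => exists_cyclePartition_eq (p i)
  let e : (Σ i, Fin (p i).1) ≃ Fin n := Fintype.equivOfCardEq (by simp [hp])
  let x : Coloring n I := fun a => (e.symm a).1
  let g : Equiv.Perm (Fin n) := (e.symm.trans (Equiv.sigmaCongrRight σ)).trans e
  have hg : g • x = x := by
    refine funext fun b => ?_
    obtain ⟨a, rfl⟩ := g.surjective b
    rw [Coloring.smul_apply, Equiv.symm_apply_apply]
    simp [x, g]
  refine ⟨⟨(x, g), hg⟩, Subtype.ext (funext fun i => ?_)⟩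
  refine Eq.trans (Eq.symm ?_) (hσ i)
  refine cyclePartition_eq_iff.2 ⟨Equiv.ofBijective
    (fun t => ⟨e ⟨i, t⟩, by simp [x]⟩) ⟨fun t t' h => ?_, fun a => ?_⟩, fun t => Subtype.ext ?_⟩
  · simpa using h
  · obtain ⟨a, ha⟩ := a
    obtain ⟨⟨j, t⟩, rfl⟩ := e.surjective a
    obtain rfl : j = i := by simpa [x] using ha
    exact ⟨t, rfl⟩
  · change e ⟨i, σ i t⟩ = e (Equiv.sigmaCongrRight σ (e.symm (e ⟨i, t⟩)))
    rw [e.symm_apply_apply]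
    rfl

theorem card_quot_loop_conj :
    Nat.card (Quot (Loop.Conj (G := Equiv.Perm (Fin n)) (X := Coloring n I))) =
      Nat.card (PartitionFamily n I) := by
  refine Nat.card_congr (Equiv.ofBijective (Quot.lift Loop.partitionFamily fun l l' h =>
    Subtype.ext (funext ((Loop.conj_iff l l').1 h))) ⟨?_, ?_⟩)
  · rintro ⟨l⟩ ⟨l'⟩ h
    exact Quot.sound ((Loop.conj_iff l l').2 (congrFun (congrArg Subtype.val h)))
  · intro p
    obtain ⟨l, rfl⟩ := Loop.partitionFamily_surjective p
    exact ⟨Quot.mk _ l, rfl⟩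

/-- Families of partitions sorted by their sizes. -/
def partitionFamilyEquiv [DecidableEq I] : PartitionFamily n I ≃
    Σ l : {l // l ∈ Finset.finsuppAntidiag (Finset.univ : Finset I) n}, ∀ i, Nat.Partition (l.1 i)
    where
  toFun p := ⟨⟨Finsupp.equivFunOnFinite.symm fun i => (p.1 i).1, by
    simpa [Finset.mem_finsuppAntidiag] using p.2⟩, fun i => (p.1 i).2⟩
  invFun s := ⟨fun i => ⟨s.1.1 i, s.2 i⟩,
    (Finset.mem_finsuppAntidiag.1 s.1.2).1⟩
  left_inv p := rfl
  right_inv s := by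
    obtain ⟨⟨l, hl⟩, p⟩ := s
    obtain ⟨f, rfl⟩ := Finsupp.equivFunOnFinite.symm.surjective l
    rfl

theorem card_partitionFamily :
    (Nat.card (PartitionFamily n I) : ℤ) = PowerSeries.coeff n
      ((PowerSeries.mk fun m => (Fintype.card (Nat.Partition m) : ℤ)) ^ Fintype.card I) := by
  classical
  have h : ((PowerSeries.mk fun m => (Fintype.card (Nat.Partition m) : ℤ)) ^ Fintype.card I) =
      ∏ _i : I, PowerSeries.mk fun m => (Fintype.card (Nat.Partition m) : ℤ) := by
    simp [Finset.card_univ]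
  rw [h, PowerSeries.coeff_prod, Nat.card_congr partitionFamilyEquiv, Nat.card_eq_fintype_card,
    Fintype.card_sigma]
  simp only [Fintype.card_pi, PowerSeries.coeff_mk]
  push_cast
  exact Finset.sum_coe_sort (Finset.finsuppAntidiag (Finset.univ : Finset I) n)
    (fun l => ∏ i, (Fintype.card (Nat.Partition (l i)) : ℤ))

-- Euler's product for partitions has the geometric series in `X ^ (i + 1)` as its factors; each
-- cancels against the factor `1 - X ^ (i + 1)`.
open scoped PowerSeries.WithPiTopology in
theorem mk_card_partition_mul_eulerFunction :
    (PowerSeries.mk fun m => (Fintype.card (Nat.Partition m) : ℤ)) * eulerFunction = 1 := by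
  have h1 := Nat.Partition.hasProd_powerSeriesMk_card_restricted ℤ (fun _ => True)
  have h2 := h1.mul hasProd_eulerFunction
  have h3 (i : ℕ) : (if True then ∑' j : ℕ, (PowerSeries.X : PowerSeries ℤ) ^ ((i + 1) * j) else 1) *
      (1 - PowerSeries.X ^ (i + 1)) = 1 := by
    rw [if_pos trivial]
    simp_rw [pow_mul]
    exact PowerSeries.WithPiTopology.tsum_pow_mul_one_sub_of_constantCoeff_eq_zero (by simp)
  simp only [h3] at h2
  have h4 := h2.unique hasProd_one
  rw [← h4]
  congr 2
  ext m
  simp [Nat.Partition.restricted, Finset.card_univ]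

end Combinatorics

/-! ### The generating function of the dimensions -/

section GeneratingFunction

variable {k : Type w} [Field k] {C : Type u} [Category.{v} C] [Preadditive C] [Linear k C]

theorem IsSchurFamily.mk_dim_symPower_mul [IsAlgClosed k] [CharZero k] {I : Type} [Fintype I]
    {S : I → C} (hS : IsSchurFamily k S) :
    (PowerSeries.mk fun n : ℕ => (Dim (SymPower k C n) : ℤ)) * eulerFunction ^ Fintype.card I =
      1 := by
  have h : (PowerSeries.mk fun n : ℕ => (Dim (SymPower k C n) : ℤ)) =
      (PowerSeries.mk fun m => (Fintype.card (Nat.Partition m) : ℤ)) ^ Fintype.card I := by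
    ext n
    rw [PowerSeries.coeff_mk, (hS.symPower n).2, card_quot_loop_conj, card_partitionFamily]
  rw [h, ← mul_pow, mk_card_partition_mul_eulerFunction, one_pow]

theorem IsSchurFamily.dim_symPower_unit [IsAlgClosed k] [CharZero k]
    {S : Unit → C} (hS : IsSchurFamily k S) (n : ℕ) :
    Dim (SymPower k C n) = Fintype.card (Nat.Partition n) := by
  have h := card_partitionFamily (n := n) (I := Unit)
  rw [← card_quot_loop_conj, ← (hS.symPower n).2, Fintype.card_unit, pow_one,
    PowerSeries.coeff_mk] at h
  exact_mod_cast h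

end GeneratingFunction

/-! ### Invariance of the dimension under equivalence -/

section Equivalence

variable {C : Type*} [Category* C] [Preadditive C] {D : Type*} [Category* D] [Preadditive D]

theorem dim_eq_of_isEquivalence (F : C ⥤ D) [F.IsEquivalence] : Dim C = Dim D := by
  refine Nat.card_congr (Equiv.ofBijective (fun c : SimpleClasses C =>
    (⟨Quotient.map F.obj (fun X Y (h : Nonempty (X ≅ Y)) => h.map F.mapIso) c.1, by
      obtain ⟨c, X, hX, rfl⟩ := c
      exact ⟨F.obj X, simple_obj F X, rfl⟩⟩ : SimpleClasses D)) ⟨?_, ?_⟩)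
  · rintro ⟨_, X, hX, rfl⟩ ⟨_, Y, hY, rfl⟩ h
    obtain ⟨i⟩ := Quotient.exact (congrArg Subtype.val h)
    exact Subtype.ext (Quotient.sound ⟨F.preimageIso i⟩)
  · rintro ⟨_, Y, hY, rfl⟩
    have : Simple (F.objPreimage Y) := by
      have := Simple.of_iso (F.objObjPreimageIso Y)
      exact (simple_obj_iff F _).1 this
    exact ⟨⟨Quotient.mk _ (F.objPreimage Y), F.objPreimage Y, this, rfl⟩,
      Subtype.ext (Quotient.sound ⟨F.objObjPreimageIso Y⟩)⟩

end Equivalence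

/-! ### Finite-dimensional vector spaces -/

section FGModule

variable (k : Type w) [Field k]

/-- The ground field as an object of the category of finite-dimensional vector spaces. -/
def groundField (_ : Unit) : FGModuleCat.{w} k := FGModuleCat.of k k

theorem isSchurFamily_groundField : IsSchurFamily k (groundField k) where
  hom_eq_zero h := (h (Subsingleton.elim _ _)).elim
  hom_self i f := by
    refine ⟨f.hom.hom (1 : k), ?_⟩
    ext
    exact (mul_one (M := k) _).symm
  id_ne_zero i h := by
    have h1 : (1 : k) = 0 := congrArg (fun f : groundField k i ⟶ groundField k i => f.hom.hom (1 : k)) h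
    exact one_ne_zero h1
  resolution X := by
    let b := Module.finBasis k X
    refine ⟨Fin (Module.finrank k X), inferInstance, fun _ => (), fun j => FGModuleCat.ofHom (b.coord j),
      fun j => FGModuleCat.ofHom (LinearMap.toSpanSingleton k X (b j)), ?_⟩
    have h (s : Finset (Fin (Module.finrank k X))) (v : X) :
        (∑ j ∈ s, (FGModuleCat.ofHom (b.coord j) : X ⟶ FGModuleCat.of k k) ≫
          FGModuleCat.ofHom (LinearMap.toSpanSingleton k X (b j))).hom.hom v =
        ∑ j ∈ s, b.repr v j • b j := by
      classical
      induction s using Finset.induction_on with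
      | empty => rfl
      | insert a s ha ih =>
        rw [Finset.sum_insert ha, Finset.sum_insert ha, ← ih]
        rfl
    ext v
    exact (h Finset.univ v).trans (b.sum_repr v)

end FGModule

/-! ### One simple object: symmetric powers and representations of the symmetric group -/

section UnitEquivalence

variable {k : Type w} [Field k] {C : Type u} [Category.{w} C] [Preadditive C] [Linear k C]
variable {n : ℕ} (S : Unit → C)

variable (k n) in
/-- The tensor power of the only simple object. -/
abbrev unitTuple : TensorTuple k C (Fin n) := tupleFamily k S fun _ => ()

variable (k n) in
/-- The tensor power of the only simple object, as an object of the tensor power. -/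
abbrev unitTensor : TensorPower k C n := (Mat_.embedding _).obj (unitTuple k n S)

theorem IsSchurFamily.unitTensor {S : Unit → C} (hS : IsSchurFamily k S) :
    IsSchurFamily k fun _ : Unit => unitTensor k n S where
  hom_eq_zero h := (h (Subsingleton.elim _ _)).elim
  hom_self _ f := hS.tuple.mat.hom_self (fun _ : Fin n => ()) f
  id_ne_zero _ := hS.tuple.mat.id_ne_zero (fun _ : Fin n => ())
  resolution X := by
    obtain ⟨J, hJ, x, p, q, h⟩ := (hS.tuple (ι := Fin n)).mat.resolution X
    obtain rfl : x = fun _ _ => () := Subsingleton.elim _ _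
    exact ⟨J, hJ, fun _ => (), p, q, h⟩

variable (k n) in
/-- The tensor power of the only simple object with its trivial equivariant structure. -/
def unitObject : SymPower k C n where
  V := unitTensor k n S
  ε g := Iso.refl (unitTensor k n S)
  compat g h := by
    change 𝟙 (unitTensor k n S) ≫ (TensorTuple.perm g).mapMat_.map (𝟙 (unitTensor k n S)) ≫ 𝟙 _ = _
    rw [Category.id_comp, CategoryTheory.Functor.map_id]
    exact Category.comp_id _

/-- The multiplicity space of the tensor power of the only simple object, as a representation. -/
def multiplicity (M : SymPower k C n) :
    Representation k (Equiv.Perm (Fin n)) (unitTensor k n S ⟶ M.V) where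
  toFun g := Equivariant.conj (unitObject k n S) M g
  map_one' := LinearMap.ext fun f => Equivariant.conj_one (unitObject k n S) M f
  map_mul' g h := LinearMap.ext fun f => (Equivariant.conj_conj (unitObject k n S) M g h f).symm

variable {S}

theorem multiplicity_comp {M N : SymPower k C n} (F : M ⟶ N) (g : Equiv.Perm (Fin n))
    (f : unitTensor k n S ⟶ M.V) : multiplicity S N g (f ≫ F.1) = multiplicity S M g f ≫ F.1 := by
  have := Equivariant.conj_comp (A := unitObject k n S) g f F.1
  rw [Equivariant.conj_hom] at this
  exact this

/-- The functor to representations given by multiplicity spaces. -/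
def multiplicityFunctor (hS : IsSchurFamily k S) :
    SymPower k C n ⥤ FDRep k (Equiv.Perm (Fin n)) where
  obj M :=
    haveI := hS.unitTensor.finite_hom (unitTensor k n S) M.V
    FDRep.of (multiplicity S M)
  map {M N} F :=
    haveI := hS.unitTensor.finite_hom (unitTensor k n S) M.V
    haveI := hS.unitTensor.finite_hom (unitTensor k n S) N.V
    { hom := FGModuleCat.ofHom (Linear.rightComp k (unitTensor k n S) F.1)
      comm := fun g => FGModuleCat.hom_ext (LinearMap.ext fun f =>
        (multiplicity_comp F g f).symm) }
  map_id M := Action.Hom.ext (FGModuleCat.hom_ext (LinearMap.ext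
    fun f : unitTensor k n S ⟶ M.V => Category.comp_id f))
  map_comp {M _ _} F F' := Action.Hom.ext (FGModuleCat.hom_ext (LinearMap.ext
    fun f : unitTensor k n S ⟶ M.V => (Category.assoc f F.1 F'.1).symm))

theorem multiplicityFunctor_additive (hS : IsSchurFamily k S) :
    (multiplicityFunctor (n := n) hS).Additive where
  map_add {M _ F F'} := Action.Hom.ext (FGModuleCat.hom_ext (LinearMap.ext
    fun f : unitTensor k n S ⟶ M.V => Preadditive.comp_add _ _ _ f F.1 F'.1))

theorem multiplicityFunctor_linear (hS : IsSchurFamily k S) :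
    (multiplicityFunctor (n := n) hS).Linear k where
  map_smul {M _} F r := Action.Hom.ext (FGModuleCat.hom_ext (LinearMap.ext
    fun f : unitTensor k n S ⟶ M.V => Linear.comp_smul _ _ _ f r F.1))

theorem multiplicityFunctor_faithful (hS : IsSchurFamily k S) :
    (multiplicityFunctor (n := n) hS).Faithful where
  map_injective h := Subtype.ext (hS.unitTensor.hom_ext fun _ a =>
    LinearMap.congr_fun (congrArg (fun t => t.hom.hom.hom) h) a)

/-- A linear map of multiplicity spaces lifts to a morphism `f` of underlying objects; it is
equivariant because `f` and its conjugates induce the same map. -/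
theorem multiplicityFunctor_full (hS : IsSchurFamily k S) :
    (multiplicityFunctor (n := n) hS).Full where
  map_surjective {M N} θ := by
    let L : (unitTensor k n S ⟶ M.V) →ₗ[k] (unitTensor k n S ⟶ N.V) := θ.hom.hom.hom
    have hL (g) (a) : L (multiplicity S M g a) = multiplicity S N g (L a) :=
      LinearMap.congr_fun (congrArg (fun t => t.hom.hom) (θ.comm g)) a
    obtain ⟨f, hf⟩ := hS.unitTensor.exists_hom fun _ => L
    refine ⟨⟨f, Equivariant.mem_homs_iff.2 fun g => hS.unitTensor.hom_ext fun i a => ?_⟩,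
      Action.Hom.ext (FGModuleCat.hom_ext (LinearMap.ext fun a => hf () a))⟩
    -- Writing `a` as the translate by `g` of another vector lets the conjugate of `f` be evaluated
    -- on `a`.
    have h1 : multiplicity S M g (multiplicity S M g⁻¹ a) = a := by
      rw [← Module.End.mul_apply, ← map_mul, mul_inv_cancel, map_one, Module.End.one_apply]
    have h2 := Equivariant.conj_comp (A := unitObject k n S) g (multiplicity S M g⁻¹ a) f
    have h3 : multiplicity S N g (multiplicity S M g⁻¹ a ≫ f) =
      multiplicity S M g (multiplicity S M g⁻¹ a) ≫ Equivariant.conj M N g f := h2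
    rw [h1, hf (), ← hL, h1] at h3
    exact h3.symm.trans (hf () a).symm

variable (k n S) in
/-- A multiple of the tensor power of the only simple object. -/
abbrev unitMultiple (r : ℕ) : TensorPower k C n := ⟨Fin r, fun _ => unitTuple k n S⟩

variable (k n S) in
/-- Matrices of scalars as endomorphisms. -/
def scalarMatrix {r : ℕ} (A : Matrix (Fin r) (Fin r) k) :
    unitMultiple k n S r ⟶ unitMultiple k n S r := fun i j => A i j • 𝟙 (unitTuple k n S)

theorem scalarMatrix_one (r : ℕ) : scalarMatrix k n S (1 : Matrix (Fin r) (Fin r) k) = 𝟙 _ := by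
  refine Mat_.hom_ext _ _ fun i j => ?_
  by_cases h : i = j
  · subst h
    rw [Mat_.id_apply_self, scalarMatrix, Matrix.one_apply_eq, one_smul]
  · rw [Mat_.id_apply_of_ne _ _ _ h, scalarMatrix, Matrix.one_apply_ne h, zero_smul]

theorem scalarMatrix_mul {r : ℕ} (A B : Matrix (Fin r) (Fin r) k) :
    scalarMatrix k n S (A * B) = scalarMatrix k n S A ≫ scalarMatrix k n S B := by
  refine Mat_.hom_ext _ _ fun i j => ?_
  rw [Mat_.comp_apply]
  simp only [scalarMatrix, Matrix.mul_apply, Finset.sum_smul, Linear.comp_smul, Category.comp_id,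
    smul_smul, mul_comm]

/-- Permutations of the factors fix scalar multiples of the identity, so the equivariance condition
on a scalar matrix structure is just multiplicativity. -/
theorem perm_map_scalarMatrix {r : ℕ} (A : Matrix (Fin r) (Fin r) k) (g : Equiv.Perm (Fin n)) :
    (TensorTuple.perm g).mapMat_.map (scalarMatrix k n S A) = scalarMatrix k n S A :=
  Mat_.hom_ext _ _ fun i j => ((TensorTuple.perm g).map_smul (A i j) (𝟙 (unitTuple k n S))).trans
    (congrArg (A i j • ·) ((TensorTuple.perm g).map_id _))

/-- The equivariant object defined by a matrix representation. -/
@[reducible]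
def ofMatrixRep {r : ℕ} (A : Equiv.Perm (Fin n) → Matrix (Fin r) (Fin r) k) (h1 : A 1 = 1)
    (hmul : ∀ g h, A (g * h) = A g * A h) : SymPower k C n where
  V := unitMultiple k n S r
  ε g :=
    ({ hom := scalarMatrix k n S (A g)
       inv := scalarMatrix k n S (A g⁻¹)
       hom_inv_id := by rw [← scalarMatrix_mul, ← hmul, mul_inv_cancel, h1, scalarMatrix_one]
       inv_hom_id := by rw [← scalarMatrix_mul, ← hmul, inv_mul_cancel, h1, scalarMatrix_one] } :
      unitMultiple k n S r ≅ unitMultiple k n S r)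
  compat g h := by
    refine (congrArg (scalarMatrix k n S (A g) ≫ ·) ((Category.comp_id _).trans
      (perm_map_scalarMatrix (A h) g))).trans ?_
    exact (scalarMatrix_mul (A g) (A h)).symm.trans (congrArg _ (hmul g h).symm)

variable (k n S) in
/-- Row vectors of scalars as morphisms. -/
def scalarRow (r : ℕ) : (Fin r → k) →ₗ[k] (unitTensor k n S ⟶ unitMultiple k n S r) where
  toFun v := fun _ j => v j • 𝟙 (unitTuple k n S)
  map_add' v v' := Mat_.hom_ext _ _ fun _ j => add_smul (v j) (v' j) _
  map_smul' c v := Mat_.hom_ext _ _ fun _ j => mul_smul c (v j) _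

theorem scalarRow_bijective (hS : IsSchurFamily k S) (r : ℕ) :
    Function.Bijective (scalarRow k n S r) := by
  constructor
  · intro v v' h
    funext j
    have h1 : v j • 𝟙 (unitTuple k n S) = v' j • 𝟙 (unitTuple k n S) :=
      congrArg (fun F : unitTensor k n S ⟶ unitMultiple k n S r => F PUnit.unit j) h
    exact smul_left_injective k (hS.tuple.id_ne_zero _) h1
  · intro F
    choose c hc using fun j => hS.tuple.hom_self (fun _ : Fin n => ()) (F PUnit.unit j)
    exact ⟨c, Mat_.hom_ext _ _ fun _ j => (hc j).symm⟩

theorem scalarRow_comp_scalarMatrix {r : ℕ} (v : Fin r → k) (A : Matrix (Fin r) (Fin r) k) :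
    scalarRow k n S r v ≫ scalarMatrix k n S A = scalarRow k n S r (Matrix.vecMul v A) := by
  refine Mat_.hom_ext _ _ fun i j => ?_
  change ∑ l, (v l • 𝟙 (unitTuple k n S)) ≫ (A l j • 𝟙 (unitTuple k n S)) =
    (∑ l, v l * A l j) • 𝟙 (unitTuple k n S)
  simp only [Finset.sum_smul, Linear.comp_smul, Category.comp_id, smul_smul, mul_comm]

theorem perm_map_scalarRow {r : ℕ} (v : Fin r → k) (g : Equiv.Perm (Fin n)) :
    (TensorTuple.perm g).mapMat_.map (scalarRow k n S r v) = scalarRow k n S r v :=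
  Mat_.hom_ext _ _ fun _ j => ((TensorTuple.perm g).map_smul (v j) (𝟙 (unitTuple k n S))).trans
    (congrArg (v j • ·) ((TensorTuple.perm g).map_id _))

/-- Conjugation ends with the inverse of the structure isomorphism; hence the action on row vectors
is by `A g⁻¹` from the right. -/
theorem multiplicity_ofMatrixRep {r : ℕ} (A : Equiv.Perm (Fin n) → Matrix (Fin r) (Fin r) k)
    (h1 : A 1 = 1) (hmul : ∀ g h, A (g * h) = A g * A h) (g : Equiv.Perm (Fin n)) (v : Fin r → k) :
    multiplicity S (ofMatrixRep A h1 hmul) g (scalarRow k n S r v) =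
      scalarRow k n S r (Matrix.vecMul v (A g⁻¹)) := by
  refine (Category.id_comp ((TensorTuple.perm g).mapMat_.map (scalarRow k n S r v) ≫
    scalarMatrix k n S (A g⁻¹))).trans ?_
  refine (congrArg (· ≫ scalarMatrix k n S (A g⁻¹)) (perm_map_scalarRow v g)).trans ?_
  exact scalarRow_comp_scalarMatrix v (A g⁻¹)

theorem multiplicityFunctor_essSurj (hS : IsSchurFamily k S) :
    (multiplicityFunctor (n := n) hS).EssSurj where
  mem_essImage W := by
    let b := Module.finBasis k W
    -- Transposition turns the right action on rows into the action on coordinates, and the inverse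
    -- undoes the one in `multiplicity_ofMatrixRep`. Both reverse products, so `A` is
    -- multiplicative.
    let A (g : Equiv.Perm (Fin n)) : Matrix _ _ k := (LinearMap.toMatrix b b (W.ρ g⁻¹)).transpose
    have h1 : A 1 = 1 := by
      simp only [A, inv_one, map_one, LinearMap.toMatrix_one, Matrix.transpose_one]
    have hmul (g h) : A (g * h) = A g * A h := by
      simp only [A, mul_inv_rev, map_mul, LinearMap.toMatrix_mul, Matrix.transpose_mul]
    let L : (unitTensor k n S ⟶ unitMultiple k n S (Module.finrank k W)) ≃ₗ[k] W :=
      (LinearEquiv.ofBijective _ (scalarRow_bijective hS _)).symm.trans b.equivFun.symm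
    have hL (g) (f) : L (multiplicity S (ofMatrixRep A h1 hmul) g f) = W.ρ g (L f) := by
      obtain ⟨v, rfl⟩ := (scalarRow_bijective hS _).2 f
      have hv (v) : L (scalarRow k n S _ v) = b.equivFun.symm v := congrArg b.equivFun.symm
        ((LinearEquiv.ofBijective _ (scalarRow_bijective hS _)).symm_apply_apply v)
      rw [multiplicity_ofMatrixRep, hv, hv]
      apply b.equivFun.injective
      rw [LinearEquiv.apply_symm_apply, Matrix.vecMul_transpose, inv_inv]
      have h3 := LinearMap.toMatrix_mulVec_repr b b (W.ρ g) (b.equivFun.symm v)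
      rw [← b.equivFun_apply, b.equivFun.apply_symm_apply] at h3
      exact h3
    refine ⟨ofMatrixRep (S := S) A h1 hmul, ⟨Action.mkIso ?_ ?_⟩⟩
    · haveI := hS.unitTensor.finite_hom (unitTensor k n S) (unitMultiple k n S (Module.finrank k W))
      exact LinearEquiv.toFGModuleCatIso L
    · intro g
      exact FGModuleCat.hom_ext (LinearMap.ext fun f => hL g f)

theorem multiplicityFunctor_isEquivalence (hS : IsSchurFamily k S) :
    (multiplicityFunctor (n := n) hS).IsEquivalence where
  faithful := multiplicityFunctor_faithful hS
  full := multiplicityFunctor_full hS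
  essSurj := multiplicityFunctor_essSurj hS

end UnitEquivalence

end LinCat

end

theorem mainTheorem8 (k : Type w) [Field k] [IsAlgClosed k] [CharZero k] :
    (∀ (V : Type u) [Category.{v} V] [Preadditive V] [Linear k V] [LinCat.IsTwoVectorSpace k V]
      (d : ℕ), LinCat.Dim V = d →
        (∀ n : ℕ, LinCat.IsTwoVectorSpace k (LinCat.SymPower k V n)) ∧
        (PowerSeries.mk fun n : ℕ => (LinCat.Dim (LinCat.SymPower k V n) : ℤ)) *
          LinCat.eulerFunction ^ d = 1) ∧
    (∀ n : ℕ,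
      (∃ e : LinCat.SymPower k (FGModuleCat.{w} k) n ≌ FDRep k (Equiv.Perm (Fin n)),
        e.functor.Additive ∧ e.functor.Linear k) ∧
      LinCat.Dim (LinCat.SymPower k (FGModuleCat.{w} k) n) = Fintype.card (Nat.Partition n) ∧
      LinCat.Dim (FDRep k (Equiv.Perm (Fin n))) = Fintype.card (Nat.Partition n)) := by
  constructor
  · intro V _ _ _ _ d hd
    subst hd
    obtain ⟨S, hS⟩ := LinCat.IsTwoVectorSpace.exists_isSchurFamily (k := k) (C := V)
    refine ⟨fun n => (hS.symPower n).1, ?_⟩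
    have h := hS.mk_dim_symPower_mul
    rwa [Fintype.card_fin] at h
  · intro n
    have hS := LinCat.isSchurFamily_groundField k
    have := LinCat.multiplicityFunctor_isEquivalence (n := n) hS
    refine ⟨⟨(LinCat.multiplicityFunctor hS).asEquivalence,
      LinCat.multiplicityFunctor_additive hS, LinCat.multiplicityFunctor_linear hS⟩,
      hS.dim_symPower_unit n, ?_⟩
    -- The simple representations are counted by transport from the symmetric power.
    exact (LinCat.dim_eq_of_isEquivalence (LinCat.multiplicityFunctor hS)).symm.trans
      (hS.dim_symPower_unit n)
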